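/- Let $(\mathscr T,\mathfrak h,\mathscr T')$ be a Gel'fand triple: $\mathscr T$ is a complex topological vector space continuously and densely embedded in a complex Hilbert space $\mathfrak h$, and $\mathscr T'$ is the continuous anti-dual of $\mathscr T$, with bracket $\langle g,f\rangle=\overline{g(f)}$ for $g\in\mathscr T'$, $f\in\mathscr T$; $\mathfrak h$ is regarded as a subspace of $\mathscr T'$ through $\langle u,f\rangle=\langle u,f\rangle_{\mathfrak h}$. Let $\mathcal F(\mathfrak h)$ be the symmetric Fock space and $\mathcal F_{\mathrm{fin}}(\mathscr T)$ the space of vectors with finitely many nonzero components, each an algebraic symmetric tensor over $\mathscr T$. For $g\in\mathscr T'$ the annihilation operator $a(g)$ acts on $\mathcal F_{\mathrm{fin}}(\mathscr T)$ by $$(a(g)\Psi)_n=\frac{\sqrt{n+1}}{(n+1)!}\sum_{\sigma}\langle g,\psi_{\sigma(1)}\rangle\,\psi_{\sigma(2)}\otimes\cdots\otimes\psi_{\sigma(n+1)}\quad\text{if }\Psi_{n+1}=\psi_1\otimes_{\mathsf s}\cdots\otimes_{\mathsf s}\psi_{n+1},$$ and $e^{a(g)}=\sum_k a(g)^k/k!$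 (a finite sum on each vector). Let $\mathcal F_g$ be the completion of $\mathcal F_{\mathrm{fin}}(\mathscr T)$ for the inner product $\langle\Psi,\Phi\rangle_g=\langle e^{a(g)}\Psi,e^{a(g)}\Phi\rangle_{\mathcal F(\mathfrak h)}$, so that $\mathcal F_0=\mathcal F(\mathfrak h)$, and let $U_{g,g'}:\mathcal F_g\to\mathcal F_{g'}$ be the unitary operator extending $\Psi\mapsto e^{a(g-g')}\Psi$. For $f\in\mathscr T$ let $\phi_0(f)=\frac1{\sqrt2}(a^\dagger(f)+a(f))$ and $\pi_0(f)=\frac1{i\sqrt2}(a^\dagger(f)-a(f))$ be the free self-adjoint field and conjugate momentum on $\mathcal F(\mathfrak h)$ (closures from the finite particle vectors), and define the interacting field and conjugate momentum on $\mathcal F_g$ by $$\phi_g(f)=U_{0,g}\bigl(\phi_0(f)+\sqrt2\,\mathrm{Re}\langle g,f\rangle\bigr)U_{g,0},\qquad \pi_g(f)=U_{0,g}\bigl(\pi_0(f)+\sqrt2\,\mathrm{Im}\langle g,f\rangle\bigr)U_{g,0}.$$ **Proposition.** 1. For all $g,g'\in\mathscr T'$ and $f\in\mathscr T$, as unbounded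 operators (equality of domains included), $$\phi_g(f)=U_{g',g}\bigl(\phi_{g'}(f)+\sqrt2\,\mathrm{Re}\langle g-g',f\rangle\bigr)U_{g,g'},\qquad \pi_g(f)=U_{g',g}\bigl(\pi_{g'}(f)+\sqrt2\,\mathrm{Im}\langle g-g',f\rangle\bigr)U_{g,g'}.$$ 2. For all $g,g'\in\mathscr T'$, the CCR representations $(\phi_g,\pi_g)$ on $\mathcal F_g$ and $(\phi_{g'},\pi_{g'})$ on $\mathcal F_{g'}$ are unitarily equivalent (there is a unitary $V:\mathcal F_g\to\mathcal F_{g'}$ with $\phi_g(f)=V^{-1}\phi_{g'}(f)V$ and $\pi_g(f)=V^{-1}\pi_{g'}(f)V$ for all $f\in\mathscr T$) if and only if $g-g'\in\mathfrak h$. 3. If $g\in\mathscr T'\smallsetminus\mathfrak h$, the representation $(\phi_g,\pi_g)$ on $\mathcal F_g$ is disjoint from the Fock representation $(\phi_0,\pi_0)$ on $\mathcal F(\mathfrak h)$: the only bounded operator $S:\mathcal F_g\to\mathcal F(\mathfrak h)$ with $S\phi_g(f)\subseteq\phi_0(f)S$ and $S\pi_g(f)\subseteq\pi_0(f)S$ for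 all $f\in\mathscr T$ is $S=0$. -/

import Mathlib

open scoped TensorProduct InnerProductSpace
open UniformSpace

noncomputable section

namespace VanHove

section Algebra

variable {E F : Type*} [AddCommGroup E] [Module ℂ E] [AddCommGroup F] [Module ℂ F]

/-- Permutation of the factors of a tensor. -/
def permute (n : ℕ) (σ : Equiv.Perm (Fin n)) : ⨂[ℂ]^n E →ₗ[ℂ] ⨂[ℂ]^n E :=
  (PiTensorProduct.reindex ℂ (fun _ : Fin n => E) σ).toLinearMap

theorem permute_tprod {n : ℕ} (σ : Equiv.Perm (Fin n)) (f : Fin n → E) :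
    permute n σ (PiTensorProduct.tprod ℂ f) = PiTensorProduct.tprod ℂ (fun i => f (σ.symm i)) := by
  simp [permute]

theorem permute_mul {n : ℕ} (σ τ : Equiv.Perm (Fin n)) :
    (permute n (σ * τ) : ⨂[ℂ]^n E →ₗ[ℂ] ⨂[ℂ]^n E) = permute n σ ∘ₗ permute n τ := by
  ext f
  simp only [LinearMap.compMultilinearMap_apply, LinearMap.comp_apply, permute_tprod]
  rfl

/-- The algebraic `n`-fold symmetric tensor power: tensors invariant under all permutations. -/
def symTensor (n : ℕ) (E : Type*) [AddCommGroup E] [Module ℂ E] : Submodule ℂ (⨂[ℂ]^n E) where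
  carrier := {x | ∀ σ : Equiv.Perm (Fin n), permute n σ x = x}
  add_mem' hx hy σ := by rw [map_add, hx σ, hy σ]
  zero_mem' σ := map_zero _
  smul_mem' c x hx σ := by rw [map_smul, hx σ]

/-- The symmetrizer `(1/n!) ∑_σ σ`, so that
`f₁ ⊗ₛ ⋯ ⊗ₛ fₙ = (1/n!) ∑_σ f_{σ(1)} ⊗ ⋯ ⊗ f_{σ(n)}`. -/
def symmetrizer (n : ℕ) : ⨂[ℂ]^n E →ₗ[ℂ] symTensor n E :=
  LinearMap.codRestrict (symTensor n E)
    (((n.factorial : ℂ)⁻¹) • ∑ σ : Equiv.Perm (Fin n), permute n σ) (by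
      intro x τ
      simp only [LinearMap.smul_apply, LinearMap.sum_apply, map_smul, map_sum]
      congr 1
      refine Fintype.sum_equiv (Equiv.mulLeft τ) _ _ fun σ => ?_
      rw [Equiv.coe_mulLeft, permute_mul]; rfl)

/-- Contraction of the first factor with a linear functional:
`f₁ ⊗ f₂ ⊗ ⋯ ↦ ℓ(f₁) f₂ ⊗ ⋯`. -/
def contract (n : ℕ) (ℓ : E →ₗ[ℂ] ℂ) : ⨂[ℂ]^(n + 1) E →ₗ[ℂ] ⨂[ℂ]^n E :=
  PiTensorProduct.lift
    (LinearMap.uncurryLeft (M := fun _ : Fin (n + 1) => E)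
      (ℓ.smulRight (PiTensorProduct.tprod ℂ : MultilinearMap ℂ (fun _ : Fin n => E) (⨂[ℂ]^n E))))

theorem contract_tprod {n : ℕ} (ℓ : E →ₗ[ℂ] ℂ) (f : Fin (n + 1) → E) :
    contract n ℓ (PiTensorProduct.tprod ℂ f)
      = ℓ (f 0) • PiTensorProduct.tprod ℂ (fun i : Fin n => f i.succ) := by
  simp [contract]; rfl

/-- Tensor multiplication from the left: `f₁ ⊗ ⋯ ⊗ fₙ ↦ f ⊗ f₁ ⊗ ⋯ ⊗ fₙ`. -/
def prepend (n : ℕ) (f : E) : ⨂[ℂ]^n E →ₗ[ℂ] ⨂[ℂ]^(n + 1) E :=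
  PiTensorProduct.lift
    ((PiTensorProduct.tprod ℂ :
      MultilinearMap ℂ (fun _ : Fin (n + 1) => E) (⨂[ℂ]^(n + 1) E)).curryLeft f)

theorem prepend_tprod {n : ℕ} (f : E) (h : Fin n → E) :
    prepend n f (PiTensorProduct.tprod ℂ h)
      = PiTensorProduct.tprod ℂ (Fin.cons f h : Fin (n + 1) → E) := by
  simp [prepend]

theorem permute_contract {n : ℕ} (ℓ : E →ₗ[ℂ] ℂ) (σ : Equiv.Perm (Fin n))
    (τ : Equiv.Perm (Fin (n + 1))) (h0 : τ.symm 0 = 0)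
    (hs : ∀ i : Fin n, τ.symm i.succ = (σ.symm i).succ) (x : ⨂[ℂ]^(n + 1) E) :
    permute n σ (contract n ℓ x) = contract n ℓ (permute (n + 1) τ x) := by
  have h : permute n σ ∘ₗ contract n ℓ = contract n ℓ ∘ₗ permute (n + 1) τ := by
    ext f
    simp only [LinearMap.compMultilinearMap_apply, LinearMap.comp_apply, permute_tprod,
      contract_tprod, map_smul]
    have e : (fun i : Fin n => f (σ.symm i).succ) = fun i : Fin n => f (τ.symm i.succ) := by
      funext i; rw [hs]
    have e0 : f 0 = f (τ.symm 0) := by rw [h0]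
    exact congr_arg₂ (fun (c : E) y => ℓ c • PiTensorProduct.tprod ℂ y) e0 e
  exact LinearMap.congr_fun h x

/-- Contraction on symmetric tensors. -/
def symContract (n : ℕ) (ℓ : E →ₗ[ℂ] ℂ) : symTensor (n + 1) E →ₗ[ℂ] symTensor n E :=
  (contract n ℓ).restrict (by
    intro x hx σ
    rw [permute_contract ℓ σ (Equiv.Perm.decomposeFin.symm (0, σ))
      (by rw [Equiv.symm_apply_eq]; simp) (fun i => by rw [Equiv.symm_apply_eq]; simp), hx])

theorem map_permute {n : ℕ} (j : E →ₗ[ℂ] F) (σ : Equiv.Perm (Fin n)) (x : ⨂[ℂ]^n E) :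
    permute n σ (PiTensorProduct.map (fun _ => j) x)
      = PiTensorProduct.map (fun _ => j) (permute n σ x) :=
  (PiTensorProduct.map_reindex (fun _ : Fin n => j) σ x).symm

/-- The map `j ⊗ ⋯ ⊗ j` on symmetric tensors. -/
def symMap (n : ℕ) (j : E →ₗ[ℂ] F) : symTensor n E →ₗ[ℂ] symTensor n F :=
  (PiTensorProduct.map (fun _ : Fin n => j)).restrict (by
    intro x hx σ
    rw [map_permute, hx])

/-- The space of finite particle vectors over `E`: sequences `(Ψ₀, Ψ₁, …)` with finitely many
nonzero entries, `Ψₙ` an algebraic symmetric tensor of degree `n`. -/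
def FinFock (E : Type*) [AddCommGroup E] [Module ℂ E] : Type _ := Π₀ n : ℕ, symTensor n E

instance : AddCommGroup (FinFock E) := inferInstanceAs (AddCommGroup (Π₀ n : ℕ, symTensor n E))
instance : Module ℂ (FinFock E) := inferInstanceAs (Module ℂ (Π₀ n : ℕ, symTensor n E))

/-- The component `Ψₙ`. -/
def FinFock.comp (n : ℕ) : FinFock E →ₗ[ℂ] symTensor n E :=
  DFinsupp.lapply (R := ℂ) (M := fun n : ℕ => symTensor n E) n

/-- A symmetric tensor of degree `n` as a finite particle vector. -/
def FinFock.single (n : ℕ) : symTensor n E →ₗ[ℂ] FinFock E :=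
  DFinsupp.lsingle (R := ℂ) (M := fun n : ℕ => symTensor n E) n

/-- The linear map on finite particle vectors with given values on the `n`-particle vectors. -/
def FinFock.lift {V : Type*} [AddCommGroup V] [Module ℂ V] (L : ∀ n, symTensor n E →ₗ[ℂ] V) :
    FinFock E →ₗ[ℂ] V :=
  DFinsupp.lsum (M := fun n : ℕ => symTensor n E) ℂ L

theorem FinFock.lift_single {V : Type*} [AddCommGroup V] [Module ℂ V]
    (L : ∀ n, symTensor n E →ₗ[ℂ] V) (n : ℕ) (x : symTensor n E) :
    FinFock.lift L (FinFock.single n x) = L n x :=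
  DFinsupp.lsum_single (M := fun n : ℕ => symTensor n E) ℂ L n x

theorem FinFock.ext {V : Type*} [AddCommGroup V] [Module ℂ V] {L M : FinFock E →ₗ[ℂ] V}
    (h : ∀ n x, L (FinFock.single n x) = M (FinFock.single n x)) : L = M :=
  DFinsupp.lhom_ext (M := fun n : ℕ => symTensor n E) h

theorem FinFock.induction {p : FinFock E → Prop} (h0 : p 0)
    (hs : ∀ n x, p (FinFock.single n x)) (ha : ∀ Ψ Φ, p Ψ → p Φ → p (Ψ + Φ)) (Ψ : FinFock E) :
    p Ψ := by
  classical
  exact DFinsupp.induction (β := fun n : ℕ => symTensor n E) (p := p) Ψ h0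
    (fun n x Φ _ _ h => ha _ _ (hs n x) h)

theorem FinFock.comp_single_same (n : ℕ) (x : symTensor n E) :
    FinFock.comp n (FinFock.single n x) = x :=
  DFinsupp.single_eq_same (β := fun n : ℕ => symTensor n E)

theorem FinFock.comp_single_ne {m n : ℕ} (hmn : m ≠ n) (x : symTensor n E) :
    FinFock.comp m (FinFock.single n x) = 0 :=
  DFinsupp.single_eq_of_ne (β := fun n : ℕ => symTensor n E) hmn

/-- The map `⨁ₙ j^{⊗ n}` on finite particle vectors. -/
def FinFock.map (j : E →ₗ[ℂ] F) : FinFock E →ₗ[ℂ] FinFock F :=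
  FinFock.lift fun n => FinFock.single n ∘ₗ symMap n j

/-- Annihilation: `(a Ψ)ₙ = √(n+1) · (contraction of the first factor of Ψₙ₊₁ with ℓ)`. On
`ψ₁ ⊗ₛ ⋯ ⊗ₛ ψₙ₊₁` this is `√(n+1)/(n+1)! ∑_σ ℓ(ψ_{σ(1)}) ψ_{σ(2)} ⊗ ⋯ ⊗ ψ_{σ(n+1)}`. -/
def annihilate (ℓ : E →ₗ[ℂ] ℂ) : FinFock E →ₗ[ℂ] FinFock E :=
  FinFock.lift fun n => match n with
    | 0 => 0
    | n + 1 => FinFock.single n ∘ₗ ((Real.sqrt (n + 1) : ℂ) • symContract n ℓ)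

/-- Creation: `f₁ ⊗ₛ ⋯ ⊗ₛ fₙ ↦ √(n+1) f ⊗ₛ f₁ ⊗ₛ ⋯ ⊗ₛ fₙ`. -/
def create (f : E) : FinFock E →ₗ[ℂ] FinFock E :=
  FinFock.lift fun n =>
    FinFock.single (n + 1) ∘ₗ
      ((Real.sqrt (n + 1) : ℂ) • (symmetrizer (n + 1) ∘ₗ prepend n f ∘ₗ (symTensor n E).subtype))

/-- The exponential `e^a = ∑ₖ aᵏ/k!` of the annihilation operator; on `n`-particle vectors
`aᵏ = 0` for `k > n`, so the series terminates at `k = n`. -/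
def expAnnihilate (ℓ : E →ₗ[ℂ] ℂ) : FinFock E →ₗ[ℂ] FinFock E :=
  FinFock.lift fun n =>
    (∑ k ∈ Finset.range (n + 1), ((k.factorial : ℂ)⁻¹) • annihilate ℓ ^ k) ∘ₗ FinFock.single n

theorem contract_contract_swap {n : ℕ} (ℓ ℓ' : E →ₗ[ℂ] ℂ) (x : ⨂[ℂ]^(n + 1 + 1) E) :
    contract n ℓ (contract (n + 1) ℓ' x)
      = contract n ℓ' (contract (n + 1) ℓ (permute (n + 1 + 1) (Equiv.swap 0 1) x)) := by
  have h : contract n ℓ ∘ₗ contract (n + 1) ℓ'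
      = contract n ℓ' ∘ₗ contract (n + 1) ℓ ∘ₗ permute (n + 1 + 1) (Equiv.swap 0 1) := by
    ext f
    simp only [LinearMap.compMultilinearMap_apply, LinearMap.comp_apply, permute_tprod,
      contract_tprod, map_smul, smul_smul, Equiv.symm_swap]
    have e0 : f (Equiv.swap 0 1 0) = f (Fin.succ 0) := by rw [Equiv.swap_apply_left]; rfl
    have e1 : f (Equiv.swap 0 1 (Fin.succ 0)) = f 0 := by
      rw [show (Fin.succ 0 : Fin (n + 1 + 1)) = 1 from rfl, Equiv.swap_apply_right]
    have e : (fun i : Fin n => f (Equiv.swap 0 1 i.succ.succ)) = fun i : Fin n => f i.succ.succ := by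
      funext i
      rw [Equiv.swap_apply_of_ne_of_ne (Fin.succ_ne_zero _)]
      exact fun h => Fin.succ_ne_zero i (Fin.succ_injective _ h)
    rw [mul_comm]
    congr 1
  exact LinearMap.congr_fun h x

theorem annihilate_single_zero (ℓ : E →ₗ[ℂ] ℂ) (x : symTensor 0 E) :
    annihilate ℓ (FinFock.single 0 x) = 0 := by
  rw [annihilate, FinFock.lift_single]; rfl

theorem annihilate_single_succ (ℓ : E →ₗ[ℂ] ℂ) (n : ℕ) (x : symTensor (n + 1) E) :
    annihilate ℓ (FinFock.single (n + 1) x)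
      = FinFock.single n ((Real.sqrt (n + 1) : ℂ) • symContract n ℓ x) := by
  rw [annihilate, FinFock.lift_single]; rfl

theorem annihilate_commute (ℓ ℓ' : E →ₗ[ℂ] ℂ) : Commute (annihilate ℓ) (annihilate ℓ') := by
  refine FinFock.ext fun n x => ?_
  rw [Module.End.mul_apply, Module.End.mul_apply]
  match n, x with
  | 0, x => simp only [annihilate_single_zero, map_zero]
  | 1, x => simp only [annihilate_single_succ, annihilate_single_zero]
  | n + 2, x =>
    simp only [annihilate_single_succ, map_smul]
    congr 3
    apply Subtype.ext
    change contract n ℓ (contract (n + 1) ℓ' x) = contract n ℓ' (contract (n + 1) ℓ x)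
    rw [contract_contract_swap, x.2]

theorem contract_add {n : ℕ} (ℓ ℓ' : E →ₗ[ℂ] ℂ) :
    contract n (ℓ + ℓ') = contract n ℓ + contract n ℓ' := by
  ext f
  simp only [LinearMap.compMultilinearMap_apply, LinearMap.add_apply, contract_tprod, add_smul]

theorem annihilate_add (ℓ ℓ' : E →ₗ[ℂ] ℂ) :
    annihilate (ℓ + ℓ') = annihilate ℓ + annihilate ℓ' := by
  refine FinFock.ext fun n x => ?_
  rw [LinearMap.add_apply]
  match n, x with
  | 0, x => simp only [annihilate_single_zero, add_zero]
  | n + 1, x =>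
    simp only [annihilate_single_succ, ← map_add, ← smul_add]
    congr 2
    apply Subtype.ext
    change contract n (ℓ + ℓ') x = contract n ℓ x + contract n ℓ' x
    rw [contract_add, LinearMap.add_apply]

theorem annihilate_pow_single (ℓ : E →ₗ[ℂ] ℂ) (k : ℕ) : ∀ (n : ℕ) (x : symTensor n E),
    ∃ y, (annihilate ℓ ^ k) (FinFock.single n x) = FinFock.single (n - k) y
      ∧ (n < k → (annihilate ℓ ^ k) (FinFock.single n x) = 0) := by
  induction k with
  | zero => exact fun n x => ⟨x, rfl, fun h => absurd h (Nat.not_lt_zero _)⟩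
  | succ k ih =>
    intro n x
    rw [pow_succ, Module.End.mul_apply]
    match n, x with
    | 0, x =>
      rw [annihilate_single_zero, map_zero]
      exact ⟨0, (map_zero _).symm, fun _ => rfl⟩
    | n + 1, x =>
      rw [annihilate_single_succ]
      obtain ⟨y, h1, h2⟩ := ih n ((Real.sqrt (n + 1) : ℂ) • symContract n ℓ x)
      rw [h1] at h2 ⊢
      rw [Nat.add_sub_add_right]
      exact ⟨y, rfl, fun h => h2 (Nat.lt_of_succ_lt_succ h)⟩

theorem expAnnihilate_single (ℓ : E →ₗ[ℂ] ℂ) {n N : ℕ} (hN : n ≤ N) (x : symTensor n E) :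
    expAnnihilate ℓ (FinFock.single n x)
      = ∑ k ∈ Finset.range (N + 1), ((k.factorial : ℂ)⁻¹) • (annihilate ℓ ^ k) (FinFock.single n x) := by
  rw [expAnnihilate, FinFock.lift_single]
  simp only [LinearMap.comp_apply, LinearMap.sum_apply, LinearMap.smul_apply]
  refine Finset.sum_subset (Finset.range_mono (by omega)) fun k _ hk => ?_
  obtain ⟨_, _, h⟩ := annihilate_pow_single ℓ k n x
  rw [h (by simpa using hk), smul_zero]

/-- The group law `e^{a} e^{a'} = e^{a + a'}`. -/
theorem expAnnihilate_comp (ℓ ℓ' : E →ₗ[ℂ] ℂ) :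
    expAnnihilate ℓ ∘ₗ expAnnihilate ℓ' = expAnnihilate (ℓ + ℓ') := by
  refine FinFock.ext fun n x => ?_
  have h1 : (expAnnihilate ℓ ∘ₗ expAnnihilate ℓ') (FinFock.single n x)
      = ∑ p ∈ Finset.range (n + 1) ×ˢ Finset.range (n + 1),
        (((p.1.factorial : ℂ)⁻¹) * ((p.2.factorial : ℂ)⁻¹)) •
          (annihilate ℓ ^ p.1 * annihilate ℓ' ^ p.2) (FinFock.single n x) := by
    rw [LinearMap.comp_apply, expAnnihilate_single ℓ' le_rfl, map_sum, Finset.sum_product_right]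
    refine Finset.sum_congr rfl fun j _ => ?_
    obtain ⟨y, hy, _⟩ := annihilate_pow_single ℓ' j n x
    simp only [Module.End.mul_apply]
    rw [map_smul, hy, expAnnihilate_single ℓ (Nat.sub_le n j), Finset.smul_sum]
    refine Finset.sum_congr rfl fun k _ => ?_
    rw [smul_smul, mul_comm]
  have hv : ∀ p : ℕ × ℕ, n < p.1 + p.2 →
      (annihilate ℓ ^ p.1 * annihilate ℓ' ^ p.2) (FinFock.single n x) = 0 := by
    intro p hp
    rw [Module.End.mul_apply]
    obtain ⟨y, hy, h0⟩ := annihilate_pow_single ℓ' p.2 n x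
    by_cases hc : n < p.2
    · rw [h0 hc, map_zero]
    · rw [hy]
      obtain ⟨_, _, h0'⟩ := annihilate_pow_single ℓ p.1 (n - p.2) y
      exact h0' (by omega)
  rw [h1, expAnnihilate_single _ le_rfl]
  have h2 : ∀ m ∈ Finset.range (n + 1),
      ((m.factorial : ℂ)⁻¹) • (annihilate (ℓ + ℓ') ^ m) (FinFock.single n x)
        = ∑ p ∈ ((Finset.range (n + 1) ×ˢ Finset.range (n + 1)).filter
            (fun p => p.1 + p.2 ∈ Finset.range (n + 1))).filter (fun p => p.1 + p.2 = m),
          (((p.1.factorial : ℂ)⁻¹) * ((p.2.factorial : ℂ)⁻¹)) •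
            (annihilate ℓ ^ p.1 * annihilate ℓ' ^ p.2) (FinFock.single n x) := by
    intro m hm
    have hset : ((Finset.range (n + 1) ×ˢ Finset.range (n + 1)).filter
            (fun p => p.1 + p.2 ∈ Finset.range (n + 1))).filter (fun p => p.1 + p.2 = m)
        = Finset.HasAntidiagonal.antidiagonal m := by
      ext p
      simp only [Finset.mem_filter, Finset.mem_product, Finset.mem_range,
        Finset.HasAntidiagonal.mem_antidiagonal] at hm ⊢
      omega
    rw [hset, annihilate_add, (annihilate_commute ℓ ℓ').add_pow', LinearMap.sum_apply,
      Finset.smul_sum]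
    refine Finset.sum_congr rfl fun p hp => ?_
    rw [Finset.HasAntidiagonal.mem_antidiagonal] at hp
    subst hp
    rw [LinearMap.smul_apply, ← Nat.cast_smul_eq_nsmul ℂ, smul_smul]
    congr 1
    have := Nat.add_choose_mul_factorial_mul_factorial p.1 p.2
    rw [← Nat.choose_symm_add] at this
    have hc : ((p.1 + p.2).choose p.1 : ℂ) * p.1.factorial * p.2.factorial
        = (p.1 + p.2).factorial := by exact_mod_cast this
    have f1 : (p.1.factorial : ℂ) ≠ 0 := by exact_mod_cast p.1.factorial_ne_zero
    have f2 : (p.2.factorial : ℂ) ≠ 0 := by exact_mod_cast p.2.factorial_ne_zero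
    have f3 : ((p.1 + p.2).factorial : ℂ) ≠ 0 := by exact_mod_cast (p.1 + p.2).factorial_ne_zero
    field_simp
    exact hc
  rw [Finset.sum_congr rfl h2, Finset.sum_fiberwise_of_maps_to (fun p hp => (Finset.mem_filter.1 hp).2)]
  refine (Finset.sum_filter_of_ne fun p _ hne => ?_).symm
  by_contra hcon
  exact hne (by rw [hv p (by simpa using hcon), smul_zero])

theorem expAnnihilate_zero : expAnnihilate (0 : E →ₗ[ℂ] ℂ) = LinearMap.id := by
  have hz : annihilate (0 : E →ₗ[ℂ] ℂ) = 0 := by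
    have := annihilate_add (0 : E →ₗ[ℂ] ℂ) 0
    rwa [add_zero, left_eq_add] at this
  refine FinFock.ext fun n x => ?_
  rw [expAnnihilate_single _ le_rfl, Finset.sum_range_succ']
  simp [hz]

/-- `e^a` as a linear bijection, with inverse `e^{-a}`. -/
def expAnnihilateEquiv (ℓ : E →ₗ[ℂ] ℂ) : FinFock E ≃ₗ[ℂ] FinFock E :=
  LinearEquiv.ofLinearMap (expAnnihilate ℓ) (expAnnihilate (-ℓ))
    (by rw [expAnnihilate_comp, add_neg_cancel, expAnnihilate_zero])
    (by rw [expAnnihilate_comp, neg_add_cancel, expAnnihilate_zero])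

end Algebra

section Inner

variable {h : Type*} [NormedAddCommGroup h] [InnerProductSpace ℂ h]

/-- The functional `h₁ ⊗ ⋯ ⊗ hₙ ↦ ∏ᵢ ⟨fᵢ, hᵢ⟩`. -/
def tensorFunctional {n : ℕ} (f : Fin n → h) : ⨂[ℂ]^n h →ₗ[ℂ] ℂ :=
  PiTensorProduct.lift
    ((MultilinearMap.mkPiAlgebra ℂ (Fin n) ℂ).compLinearMap (fun i => innerₛₗ ℂ (f i)))

theorem tensorFunctional_tprod {n : ℕ} (f k : Fin n → h) :
    tensorFunctional f (PiTensorProduct.tprod ℂ k) = ∏ i, inner ℂ (f i) (k i) := by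
  simp [tensorFunctional]

theorem tensorFunctional_tprod_swap {n : ℕ} (f k : Fin n → h) :
    tensorFunctional f (PiTensorProduct.tprod ℂ k)
      = starRingEnd ℂ (tensorFunctional k (PiTensorProduct.tprod ℂ f)) := by
  simp [tensorFunctional_tprod]

/-- The inner product on the algebraic tensor power, antilinear in the first argument, with
`⟨f₁ ⊗ ⋯ ⊗ fₙ, h₁ ⊗ ⋯ ⊗ hₙ⟩ = ∏ᵢ ⟨fᵢ, hᵢ⟩`. -/
def tensorInner (n : ℕ) : ⨂[ℂ]^n h →ₗ⋆[ℂ] ⨂[ℂ]^n h →ₗ[ℂ] ℂ :=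
  LinearMap.flip (PiTensorProduct.lift
    { toFun := fun f : Fin n → h =>
        (starLinearEquiv ℂ (A := ℂ)).toLinearMap.comp (tensorFunctional f)
      map_update_add' := by
        intro _ f i x y
        have e : tensorFunctional (Function.update f i (x + y))
            = tensorFunctional (Function.update f i x)
              + tensorFunctional (Function.update f i y) := by
          ext k
          simp only [LinearMap.compMultilinearMap_apply, LinearMap.add_apply]
          rw [tensorFunctional_tprod_swap, MultilinearMap.map_update_add, map_add, map_add,
            ← tensorFunctional_tprod_swap, ← tensorFunctional_tprod_swap]
        rw [e, LinearMap.comp_add]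
      map_update_smul' := by
        intro _ f i c x
        have e : tensorFunctional (Function.update f i (c • x))
            = starRingEnd ℂ c • tensorFunctional (Function.update f i x) := by
          ext k
          simp only [LinearMap.compMultilinearMap_apply, LinearMap.smul_apply]
          rw [tensorFunctional_tprod_swap, MultilinearMap.map_update_smul, map_smul, smul_eq_mul,
            map_mul, ← tensorFunctional_tprod_swap, smul_eq_mul]
        rw [e]
        refine LinearMap.ext fun y => ?_
        simp } : ⨂[ℂ]^n h →ₗ[ℂ] ⨂[ℂ]^n h →ₗ⋆[ℂ] ℂ)

theorem tensorInner_tprod {n : ℕ} (f k : Fin n → h) :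
    tensorInner n (PiTensorProduct.tprod ℂ f) (PiTensorProduct.tprod ℂ k)
      = ∏ i, inner ℂ (f i) (k i) := by
  simp [tensorInner, tensorFunctional_tprod, LinearMap.flip_apply]

theorem exists_sum_tprod {n : ℕ} (x : ⨂[ℂ]^n h) :
    ∃ c : (Fin n → h) →₀ ℂ, x = c.sum fun f a => a • PiTensorProduct.tprod ℂ f := by
  have hx : x ∈ Submodule.span ℂ (Set.range (PiTensorProduct.tprod ℂ (s := fun _ : Fin n => h))) := by
    rw [PiTensorProduct.span_tprod_eq_top]; trivial
  obtain ⟨c, hc⟩ := (Finsupp.mem_span_range_iff_exists_finsupp).1 hx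
  exact ⟨c, hc.symm⟩

theorem tensorInner_conj_symm {n : ℕ} (x y : ⨂[ℂ]^n h) :
    starRingEnd ℂ (tensorInner n y x) = tensorInner n x y := by
  obtain ⟨c, rfl⟩ := exists_sum_tprod x
  obtain ⟨d, rfl⟩ := exists_sum_tprod y
  simp only [Finsupp.sum, map_sum, LinearMap.map_smulₛₗ, LinearMap.sum_apply, LinearMap.smul_apply,
    tensorInner_tprod, smul_eq_mul, map_mul, map_prod, inner_conj_symm, Complex.conj_conj,
    RingHom.id_apply, Finset.mul_sum]
  rw [Finset.sum_comm]
  refine Finset.sum_congr rfl fun f _ => Finset.sum_congr rfl fun k _ => ?_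
  ring

open scoped ComplexOrder in
theorem posSemidef_prod_inner {α : Type*} [Fintype α] {n : ℕ} (v : α → Fin n → h) :
    (Matrix.of fun a b => ∏ i, inner ℂ (v a i) (v b i) : Matrix α α ℂ).PosSemidef := by
  induction n with
  | zero =>
    have e : (Matrix.of fun a b => ∏ i, inner ℂ (v a i) (v b i) : Matrix α α ℂ)
        = Matrix.gram ℂ (fun _ : α => (1 : ℂ)) := by
      ext a b
      simp [Matrix.gram]
    rw [e]
    exact Matrix.posSemidef_gram ℂ _
  | succ n ih =>
    have h1 := (Matrix.posSemidef_gram ℂ (fun a => v a 0)).hadamard (ih fun a i => v a i.succ)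
    have e : (Matrix.of fun a b => ∏ i, inner ℂ (v a i) (v b i) : Matrix α α ℂ)
        = Matrix.hadamard (Matrix.gram ℂ (fun a => v a 0))
          (Matrix.of fun a b => ∏ i, inner ℂ (v a (Fin.succ i)) (v b (Fin.succ i))) := by
      ext a b
      simp [Matrix.gram, Fin.prod_univ_succ]
    rw [e]
    exact h1

open scoped ComplexOrder in
theorem tensorInner_self_nonneg {n : ℕ} (x : ⨂[ℂ]^n h) : 0 ≤ (tensorInner n x x).re := by
  obtain ⟨c, rfl⟩ := exists_sum_tprod x
  have := (posSemidef_prod_inner (fun a : c.support => (a : Fin n → h))).dotProduct_mulVec_nonneg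
    (fun a => c a)
  have e : tensorInner n (c.sum fun f a => a • PiTensorProduct.tprod ℂ f)
      (c.sum fun f a => a • PiTensorProduct.tprod ℂ f)
      = star (fun a : c.support => c a) ⬝ᵥ Matrix.mulVec
        (Matrix.of fun a b : c.support => ∏ i, inner ℂ ((a : Fin n → h) i) ((b : Fin n → h) i))
        (fun a => c a) := by
    simp only [Finsupp.sum, map_sum, LinearMap.map_smulₛₗ, LinearMap.sum_apply,
      LinearMap.smul_apply, tensorInner_tprod, smul_eq_mul, RingHom.id_apply, dotProduct,
      Matrix.mulVec, Matrix.of_apply, Pi.star_apply, Finset.mul_sum]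
    rw [Finset.sum_comm, ← Finset.sum_coe_sort c.support]
    refine Finset.sum_congr rfl fun f _ => ?_
    rw [← Finset.sum_coe_sort c.support]
    refine Finset.sum_congr rfl fun k _ => ?_
    simp
    ring
  rw [e]
  exact (Complex.le_def.1 this).1

/-- The Fock inner product `⟨Ψ, Φ⟩ = ∑ₙ ⟨Ψₙ, Φₙ⟩` on finite particle vectors. -/
def finInner (Ψ : FinFock h) : FinFock h →ₗ[ℂ] ℂ :=
  FinFock.lift fun n => tensorInner n (FinFock.comp n Ψ : ⨂[ℂ]^n h) ∘ₗ (symTensor n h).subtype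

theorem finInner_single (Ψ : FinFock h) (n : ℕ) (x : symTensor n h) :
    finInner Ψ (FinFock.single n x) = tensorInner n (FinFock.comp n Ψ : ⨂[ℂ]^n h) x :=
  FinFock.lift_single _ n x

theorem finInner_add_left (Ψ Ψ' Φ : FinFock h) :
    finInner (Ψ + Ψ') Φ = finInner Ψ Φ + finInner Ψ' Φ := by
  have : finInner (Ψ + Ψ') = finInner Ψ + finInner Ψ' := by
    refine FinFock.ext fun n x => ?_
    simp [finInner_single]
  rw [this, LinearMap.add_apply]

theorem finInner_smul_left (c : ℂ) (Ψ Φ : FinFock h) :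
    finInner (c • Ψ) Φ = starRingEnd ℂ c * finInner Ψ Φ := by
  have : finInner (c • Ψ) = starRingEnd ℂ c • finInner Ψ := by
    refine FinFock.ext fun n x => ?_
    simp [finInner_single, LinearMap.map_smulₛₗ]
  rw [this, LinearMap.smul_apply, smul_eq_mul]

theorem finInner_single_single_ne {m n : ℕ} (hmn : m ≠ n) (x : symTensor m h) (y : symTensor n h) :
    finInner (FinFock.single m x) (FinFock.single n y) = 0 := by
  rw [finInner_single, FinFock.comp_single_ne hmn.symm]; simp

theorem finInner_single_single (n : ℕ) (x y : symTensor n h) :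
    finInner (FinFock.single n x) (FinFock.single n y) = tensorInner n (x : ⨂[ℂ]^n h) y := by
  rw [finInner_single, FinFock.comp_single_same]

theorem finInner_conj_symm (Ψ Φ : FinFock h) :
    starRingEnd ℂ (finInner Φ Ψ) = finInner Ψ Φ := by
  have z : ∀ Ψ : FinFock h, finInner 0 Ψ = 0 := fun Ψ => by
    simpa using finInner_smul_left 0 0 Ψ
  induction Ψ using FinFock.induction with
  | h0 => simp [z]
  | ha Ψ Ψ' h1 h2 => rw [map_add, map_add, h1, h2, finInner_add_left]
  | hs m x =>
    induction Φ using FinFock.induction with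
    | h0 => simp [z]
    | ha Φ Φ' h1 h2 => rw [finInner_add_left, map_add, h1, h2, map_add]
    | hs n y =>
      by_cases hmn : m = n
      · subst hmn
        rw [finInner_single_single, finInner_single_single, tensorInner_conj_symm]
      · rw [finInner_single_single_ne hmn, finInner_single_single_ne (Ne.symm hmn), map_zero]

theorem finInner_self_nonneg (Ψ : FinFock h) : 0 ≤ (finInner Ψ Ψ).re := by
  classical
  have e : finInner Ψ Ψ = DFinsupp.sum (β := fun n : ℕ => symTensor n h) Ψ
      fun n x => tensorInner n (FinFock.comp n Ψ : ⨂[ℂ]^n h) x :=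
    DFinsupp.sumAddHom_apply (β := fun n : ℕ => symTensor n h) _ Ψ
  rw [e]
  unfold DFinsupp.sum
  rw [Complex.re_sum]
  exact Finset.sum_nonneg fun n _ => tensorInner_self_nonneg _

/-- The Fock inner product. -/
@[reducible]
def finFockCore : PreInnerProductSpace.Core ℂ (FinFock h) where
  inner Ψ Φ := finInner Ψ Φ
  conj_inner_symm := finInner_conj_symm
  re_inner_nonneg := finInner_self_nonneg
  add_left := finInner_add_left
  smul_left Ψ Φ c := finInner_smul_left c Ψ Φ

instance : SeminormedAddCommGroup (FinFock h) :=
  @InnerProductSpace.Core.toSeminormedAddCommGroup ℂ (FinFock h) _ _ _ finFockCore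

instance : InnerProductSpace ℂ (FinFock h) := InnerProductSpace.ofCore finFockCore

theorem FinFock.inner_def (Ψ Φ : FinFock h) : inner ℂ Ψ Φ = finInner Ψ Φ := rfl

theorem FinFock.norm_sq (Ψ : FinFock h) : ‖Ψ‖ ^ 2 = (finInner Ψ Ψ).re :=
  InnerProductSpace.norm_sq_eq_re_inner (𝕜 := ℂ) Ψ

theorem symmetrizer_of_mem {n : ℕ} (x : symTensor n h) : symmetrizer n (x : ⨂[ℂ]^n h) = x := by
  apply Subtype.ext
  change (((n.factorial : ℂ)⁻¹) • ∑ σ : Equiv.Perm (Fin n), permute n σ) (x : ⨂[ℂ]^n h) = x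
  have hf : (n.factorial : ℂ) ≠ 0 := by exact_mod_cast n.factorial_ne_zero
  have hx : ∀ σ : Equiv.Perm (Fin n), permute n σ (x : ⨂[ℂ]^n h) = x := x.2
  simp only [LinearMap.smul_apply, LinearMap.sum_apply, hx, Finset.sum_const, Finset.card_univ,
    Fintype.card_perm, Fintype.card_fin]
  rw [← Nat.cast_smul_eq_nsmul ℂ, smul_smul, inv_mul_cancel₀ hf, one_smul]

/-- The multilinear map `(f₁, …, fₙ) ↦ f₁ ⊗ₛ ⋯ ⊗ₛ fₙ` into the finite particle vectors. -/
def symProd (n : ℕ) : MultilinearMap ℂ (fun _ : Fin n => h) (FinFock h) :=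
  (FinFock.single n ∘ₗ symmetrizer n).compMultilinearMap (PiTensorProduct.tprod ℂ)

theorem norm_symProd_le {n : ℕ} (f : Fin n → h) : ‖symProd n f‖ ≤ 1 * ∏ i, ‖f i‖ := by
  rw [one_mul]
  have hp : 0 ≤ ∏ i, ‖f i‖ := Finset.prod_nonneg fun i _ => norm_nonneg _
  refine (pow_le_pow_iff_left₀ (norm_nonneg _) hp two_ne_zero).1 ?_
  have hterm : ∀ σ τ : Equiv.Perm (Fin n),
      ‖tensorInner n (permute n σ (PiTensorProduct.tprod ℂ f))
        (permute n τ (PiTensorProduct.tprod ℂ f))‖ ≤ (∏ i, ‖f i‖) ^ 2 := by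
    intro σ τ
    rw [permute_tprod, permute_tprod, tensorInner_tprod, norm_prod]
    calc ∏ i, ‖inner ℂ (f (σ.symm i)) (f (τ.symm i))‖
        ≤ ∏ i, ‖f (σ.symm i)‖ * ‖f (τ.symm i)‖ :=
          Finset.prod_le_prod (fun i _ => norm_nonneg _) fun i _ => norm_inner_le_norm _ _
      _ = (∏ i, ‖f i‖) ^ 2 := by
          rw [Finset.prod_mul_distrib, Equiv.prod_comp σ.symm (fun i => ‖f i‖),
            Equiv.prod_comp τ.symm (fun i => ‖f i‖), sq]
  have hval : ((symmetrizer n (PiTensorProduct.tprod ℂ f) : symTensor n h) : ⨂[ℂ]^n h)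
      = ((n.factorial : ℂ)⁻¹) • ∑ σ : Equiv.Perm (Fin n), permute n σ (PiTensorProduct.tprod ℂ f) := by
    change (((n.factorial : ℂ)⁻¹) • ∑ σ : Equiv.Perm (Fin n), permute n σ) _ = _
    simp only [LinearMap.smul_apply, LinearMap.sum_apply]
  have hf : (n.factorial : ℝ) ≠ 0 := by exact_mod_cast n.factorial_ne_zero
  rw [FinFock.norm_sq]
  change (finInner (FinFock.single n (symmetrizer n (PiTensorProduct.tprod ℂ f)))
    (FinFock.single n (symmetrizer n (PiTensorProduct.tprod ℂ f)))).re ≤ _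
  rw [finInner_single_single, hval]
  refine (Complex.re_le_norm _).trans ?_
  simp only [LinearMap.map_smulₛₗ, map_sum, LinearMap.smul_apply, LinearMap.sum_apply,
    RingHom.id_apply, smul_eq_mul, norm_mul]
  calc _ ≤ ‖(n.factorial : ℂ)⁻¹‖ * (‖(n.factorial : ℂ)⁻¹‖ *
        ∑ _σ : Equiv.Perm (Fin n), ∑ _τ : Equiv.Perm (Fin n), (∏ i, ‖f i‖) ^ 2) := by
        rw [← Finset.mul_sum, norm_mul, RCLike.norm_conj]
        gcongr
        refine (norm_sum_le _ _).trans (Finset.sum_le_sum fun σ _ => ?_)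
        exact (norm_sum_le _ _).trans (Finset.sum_le_sum fun τ _ => hterm _ _)
    _ = (∏ i, ‖f i‖) ^ 2 := by
        simp only [Finset.sum_const, Finset.card_univ, Fintype.card_perm, Fintype.card_fin,
          nsmul_eq_mul, norm_inv, Complex.norm_natCast]
        field_simp

theorem continuous_symProd (n : ℕ) : Continuous (symProd (h := h) n) :=
  MultilinearMap.continuous_of_bound _ 1 norm_symProd_le

theorem map_symProd {E : Type*} [AddCommGroup E] [Module ℂ E] (j : E →ₗ[ℂ] h) {n : ℕ}
    (f : Fin n → E) : symProd n (fun i => j (f i))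
      = FinFock.map j (FinFock.single n (symmetrizer n (PiTensorProduct.tprod ℂ f))) := by
  rw [FinFock.map, FinFock.lift_single]
  change FinFock.single n (symmetrizer n (PiTensorProduct.tprod ℂ fun i => j (f i))) = _
  rw [LinearMap.comp_apply]
  congr 1
  apply Subtype.ext
  change (((n.factorial : ℂ)⁻¹) • ∑ σ : Equiv.Perm (Fin n), permute n σ) _
    = PiTensorProduct.map (fun _ => j)
      ((((n.factorial : ℂ)⁻¹) • ∑ σ : Equiv.Perm (Fin n), permute n σ) _)
  simp only [LinearMap.smul_apply, LinearMap.sum_apply, map_smul, map_sum, ← map_permute,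
    PiTensorProduct.map_tprod]

theorem denseRange_map {E : Type*} [AddCommGroup E] [Module ℂ E] (j : E →ₗ[ℂ] h)
    (hj : DenseRange j) : DenseRange (FinFock.map j) := by
  let S : Submodule ℂ (FinFock h) := (LinearMap.range (FinFock.map j)).topologicalClosure
  suffices hS : ∀ Ψ : FinFock h, Ψ ∈ S by
    intro Ψ
    exact hS Ψ
  have hprod : ∀ (n : ℕ) (f : Fin n → h), symProd n f ∈ S := by
    intro n f
    have hd : DenseRange (fun (t : Fin n → E) (i : Fin n) => j (t i)) :=
      DenseRange.piMap fun _ => hj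
    refine hd.induction_on (p := fun f => symProd n f ∈ S) f ?_ ?_
    · exact (Submodule.isClosed_topologicalClosure _).preimage (continuous_symProd n)
    · intro t
      rw [map_symProd]
      exact Submodule.le_topologicalClosure _ ⟨_, rfl⟩
  intro Ψ
  induction Ψ using FinFock.induction with
  | h0 => exact S.zero_mem
  | ha Ψ Φ h1 h2 => exact S.add_mem h1 h2
  | hs n x =>
    rw [← symmetrizer_of_mem x]
    obtain ⟨c, hc⟩ := exists_sum_tprod (x : ⨂[ℂ]^n h)
    rw [hc, Finsupp.sum, map_sum, map_sum]
    refine S.sum_mem fun f _ => ?_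
    rw [map_smul, map_smul]
    exact S.smul_mem _ (hprod n f)

theorem tensorInner_prepend {n : ℕ} (f : h) (x : ⨂[ℂ]^(n + 1) h) (y : ⨂[ℂ]^n h) :
    tensorInner (n + 1) x (prepend n f y) = tensorInner n (contract n (innerₛₗ ℂ f) x) y := by
  obtain ⟨c, rfl⟩ := exists_sum_tprod x
  obtain ⟨d, rfl⟩ := exists_sum_tprod y
  simp only [Finsupp.sum, map_sum, map_smul, LinearMap.map_smulₛₗ, LinearMap.sum_apply,
    LinearMap.smul_apply, prepend_tprod, contract_tprod, tensorInner_tprod, Fin.prod_univ_succ,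
    Fin.cons_zero, Fin.cons_succ, innerₛₗ_apply_apply, inner_conj_symm, smul_eq_mul]

theorem tensorInner_permute {n : ℕ} (σ : Equiv.Perm (Fin n)) (x y : ⨂[ℂ]^n h) :
    tensorInner n (permute n σ x) (permute n σ y) = tensorInner n x y := by
  obtain ⟨c, rfl⟩ := exists_sum_tprod x
  obtain ⟨d, rfl⟩ := exists_sum_tprod y
  simp only [Finsupp.sum, map_sum, map_smul, LinearMap.map_smulₛₗ, LinearMap.sum_apply,
    LinearMap.smul_apply, permute_tprod, tensorInner_tprod]
  have e : ∀ g k : Fin n → h, ∏ i, inner ℂ (g (σ.symm i)) (k (σ.symm i))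
      = ∏ i, inner ℂ (g i) (k i) := fun g k => Equiv.prod_comp σ.symm (fun i => inner ℂ (g i) (k i))
  simp only [e]

theorem tensorInner_symmetrizer {n : ℕ} (x : symTensor n h) (y : ⨂[ℂ]^n h) :
    tensorInner n (x : ⨂[ℂ]^n h) (symmetrizer n y) = tensorInner n (x : ⨂[ℂ]^n h) y := by
  change tensorInner n (x : ⨂[ℂ]^n h)
    ((((n.factorial : ℂ)⁻¹) • ∑ σ : Equiv.Perm (Fin n), permute n σ) y) = _
  have hf : (n.factorial : ℂ) ≠ 0 := by exact_mod_cast n.factorial_ne_zero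
  have hx : ∀ σ : Equiv.Perm (Fin n), tensorInner n (x : ⨂[ℂ]^n h) (permute n σ y)
      = tensorInner n (x : ⨂[ℂ]^n h) y := fun σ => by
    conv_lhs => rw [← x.2 σ]
    exact tensorInner_permute σ _ _
  simp only [LinearMap.smul_apply, LinearMap.sum_apply, map_smul, map_sum, hx, Finset.sum_const,
    Finset.card_univ, Fintype.card_perm, Fintype.card_fin]
  rw [← Nat.cast_smul_eq_nsmul ℂ, smul_smul, inv_mul_cancel₀ hf, one_smul]

/-- The annihilation operator `a(f)`, `f ∈ h`, on finite particle vectors. -/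
def ann (f : h) : FinFock h →ₗ[ℂ] FinFock h := annihilate (innerₛₗ ℂ f)

/-- Creation and annihilation operators are formal adjoints of each other. -/
theorem finInner_create (f : h) (Ψ Φ : FinFock h) :
    finInner Ψ (create f Φ) = finInner (ann f Ψ) Φ := by
  have z : ∀ Ψ : FinFock h, finInner 0 Ψ = 0 := fun Ψ => by
    simpa using finInner_smul_left 0 0 Ψ
  induction Φ using FinFock.induction with
  | h0 => simp
  | ha Φ Φ' h1 h2 => rw [map_add, map_add, h1, h2, map_add]
  | hs n y =>
    induction Ψ using FinFock.induction with
    | h0 => rw [map_zero, z, z]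
    | ha Ψ Ψ' h1 h2 => rw [finInner_add_left, h1, h2, map_add, finInner_add_left]
    | hs m x =>
      rw [create, FinFock.lift_single, LinearMap.comp_apply]
      match m, x with
      | 0, x =>
        rw [ann, annihilate_single_zero, z, finInner_single_single_ne (Nat.succ_ne_zero n).symm]
      | m + 1, x =>
        rw [ann, annihilate_single_succ]
        by_cases hmn : m = n
        · subst hmn
          rw [finInner_single_single, finInner_single_single]
          simp only [LinearMap.smul_apply, LinearMap.comp_apply, Submodule.coe_smul, map_smul,
            LinearMap.map_smulₛₗ, Complex.conj_ofReal, Submodule.subtype_apply]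
          rw [tensorInner_symmetrizer, tensorInner_prepend]
          rfl
        · rw [finInner_single_single_ne hmn,
            finInner_single_single_ne (fun e => hmn (Nat.succ_injective e))]

/-- The symmetric Fock space `F(h)`: the Hilbert direct sum of the symmetric tensor powers of `h`,
realised as the completion of the space of finite particle vectors. -/
abbrev FockSpace (h : Type*) [NormedAddCommGroup h] [InnerProductSpace ℂ h] : Type _ :=
  Completion (FinFock h)

/-- The Segal field `(a†(f) + a(f))/√2` on finite particle vectors. -/
def finField (f : h) : FinFock h →ₗ[ℂ] FinFock h :=
  ((Real.sqrt 2 : ℂ)⁻¹) • (create f + ann f)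

/-- The conjugate momentum `(a†(f) - a(f))/(i√2)` on finite particle vectors. -/
def finMomentum (f : h) : FinFock h →ₗ[ℂ] FinFock h :=
  ((Complex.I * (Real.sqrt 2 : ℂ))⁻¹) • (create f - ann f)

/-- The graph in `F(h) × F(h)` of an operator with domain the finite particle vectors. -/
def finGraph (A : FinFock h →ₗ[ℂ] FinFock h) : Submodule ℂ (FockSpace h × FockSpace h) :=
  LinearMap.range
    ((Completion.toComplₗᵢ (𝕜 := ℂ) (E := FinFock h)).toLinearMap.prod
      ((Completion.toComplₗᵢ (𝕜 := ℂ) (E := FinFock h)).toLinearMap ∘ₗ A))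

/-- The closure, as an unbounded operator on `F(h)`, of an operator on finite particle vectors: the
operator whose graph is the closure of the graph of `A`. -/
def finClosure (A : FinFock h →ₗ[ℂ] FinFock h) : FockSpace h →ₗ.[ℂ] FockSpace h :=
  (finGraph A).topologicalClosure.toLinearPMap

/-- A symmetric operator on finite particle vectors is closable. -/
theorem finClosure_graph (A : FinFock h →ₗ[ℂ] FinFock h)
    (hA : ∀ Ψ Φ, finInner (A Ψ) Φ = finInner Ψ (A Φ)) :
    (finClosure A).graph = (finGraph A).topologicalClosure := by
  refine Submodule.toLinearPMap_graph_eq _ fun p hp hp1 => ?_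
  have key : ∀ (Χ : FinFock h) (q : FockSpace h × FockSpace h),
      q ∈ (finGraph A).topologicalClosure →
      inner ℂ (Χ : FockSpace h) q.2 = inner ℂ ((A Χ : FinFock h) : FockSpace h) q.1 := by
    intro Χ q hq
    refine closure_minimal (t := {q : FockSpace h × FockSpace h | inner ℂ (Χ : FockSpace h) q.2
      = inner ℂ ((A Χ : FinFock h) : FockSpace h) q.1}) ?_
      (isClosed_eq (by fun_prop) (by fun_prop)) hq
    rintro _ ⟨Ψ, rfl⟩
    change inner ℂ (Χ : FockSpace h) ((A Ψ : FinFock h) : FockSpace h)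
      = inner ℂ ((A Χ : FinFock h) : FockSpace h) (Ψ : FockSpace h)
    rw [Completion.inner_coe, Completion.inner_coe]
    exact (hA Χ Ψ).symm
  have h0 : ∀ v : FockSpace h, inner ℂ v p.2 = 0 := by
    intro v
    refine Completion.denseRange_coe.induction_on v (isClosed_eq (by fun_prop) (by fun_prop)) ?_
    intro Χ
    rw [key Χ p hp, hp1, inner_zero_right]
  exact inner_self_eq_zero.1 (h0 p.2)

theorem finField_symm (f : h) (Ψ Φ : FinFock h) :
    finInner (finField f Ψ) Φ = finInner Ψ (finField f Φ) := by
  have hc : finInner (create f Ψ) Φ = finInner Ψ (ann f Φ) := by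
    rw [← finInner_conj_symm, finInner_create, finInner_conj_symm]
  simp only [finField, LinearMap.smul_apply, LinearMap.add_apply, finInner_smul_left,
    finInner_add_left, map_smul, map_add, finInner_create, hc, smul_eq_mul, map_inv₀,
    Complex.conj_ofReal]
  ring

theorem finMomentum_symm (f : h) (Ψ Φ : FinFock h) :
    finInner (finMomentum f Ψ) Φ = finInner Ψ (finMomentum f Φ) := by
  have hc : finInner (create f Ψ) Φ = finInner Ψ (ann f Φ) := by
    rw [← finInner_conj_symm, finInner_create, finInner_conj_symm]
  have hs : ∀ Ψ Ψ' Φ : FinFock h, finInner (Ψ - Ψ') Φ = finInner Ψ Φ - finInner Ψ' Φ := by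
    intro Ψ Ψ' Φ
    have := finInner_smul_left (-1) Ψ' Φ
    rw [sub_eq_add_neg, finInner_add_left, ← neg_one_smul ℂ Ψ', this]
    simp
    ring
  simp only [finMomentum, LinearMap.smul_apply, LinearMap.sub_apply, finInner_smul_left, hs,
    map_smul, map_sub, finInner_create, hc, smul_eq_mul, map_inv₀, map_mul, Complex.conj_I,
    Complex.conj_ofReal, neg_mul, inv_neg]
  ring

/-- The (self-adjoint) Segal field operator `φ₀(f)` on `F(h)`: the closure of
`(a†(f) + a(f))/√2`. -/
def fockField (f : h) : FockSpace h →ₗ.[ℂ] FockSpace h := finClosure (finField f)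

/-- The (self-adjoint) conjugate momentum `π₀(f)` on `F(h)`: the closure of
`(a†(f) - a(f))/(i√2)`. -/
def fockMomentum (f : h) : FockSpace h →ₗ.[ℂ] FockSpace h := finClosure (finMomentum f)

end Inner

section Operators

variable {H K : Type*} [NormedAddCommGroup H] [InnerProductSpace ℂ H]
  [NormedAddCommGroup K] [InnerProductSpace ℂ K]

/-- The operator `A + c`, with the domain of `A`. -/
def addScalar (A : H →ₗ.[ℂ] H) (c : ℂ) : H →ₗ.[ℂ] H where
  domain := A.domain
  toFun := A.toFun + c • A.domain.subtype

/-- The product `V A U` of an unbounded operator `A` on `K` with everywhere defined maps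
`U : H → K` and `V : K → H`, on its natural domain `{x | U x ∈ D(A)}`. -/
def sandwich (V : K ≃ₗᵢ[ℂ] H) (A : K →ₗ.[ℂ] K) (U : H ≃ₗᵢ[ℂ] K) : H →ₗ.[ℂ] H where
  domain := A.domain.comap U.toLinearEquiv.toLinearMap
  toFun := V.toLinearEquiv.toLinearMap ∘ₗ A.toFun ∘ₗ
    U.toLinearEquiv.toLinearMap.restrict (fun _ hx => hx)

/-- Families `φ(f)`, `π(f)` of unbounded operators on `H` indexed by test functions `f`. -/
structure FieldOperators (T : Type*) (H : Type*) [NormedAddCommGroup H] [InnerProductSpace ℂ H] where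
  φ : T → H →ₗ.[ℂ] H
  π : T → H →ₗ.[ℂ] H

/-- Unitary equivalence: a unitary `V : H → K` with `φ(f) = V⁻¹ φ'(f) V` and
`π(f) = V⁻¹ π'(f) V` for all `f`, including equality of domains. -/
def UnitarilyEquivalent {T : Type*} (R : FieldOperators T H) (R' : FieldOperators T K) : Prop :=
  ∃ V : H ≃ₗᵢ[ℂ] K, ∀ f, R.φ f = sandwich V.symm (R'.φ f) V ∧ R.π f = sandwich V.symm (R'.π f) V

/-- The bounded operator `S` intertwines `A` and `B`: `S A ⊆ B S`. -/
def Intertwines (S : H →L[ℂ] K) (A : H →ₗ.[ℂ] H) (B : K →ₗ.[ℂ] K) : Prop :=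
  ∀ x : A.domain, ∃ hx : S x ∈ B.domain, B ⟨S x, hx⟩ = S (A x)

/-- Disjointness: the only bounded intertwining operator is zero. -/
def DisjointRep {T : Type*} (R : FieldOperators T H) (R' : FieldOperators T K) : Prop :=
  ∀ S : H →L[ℂ] K,
    (∀ f, Intertwines S (R.φ f) (R'.φ f) ∧ Intertwines S (R.π f) (R'.π f)) → S = 0

end Operators

/-- A Gel'fand triple `T ⊆ h ⊆ T'`: a topological vector space `T` continuously and densely
embedded in the Hilbert space `h`. The space `T'` is the continuous anti-dual
`T →L⋆[ℂ] ℂ` of `T`. -/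
structure GelfandTriple (T h : Type*) [AddCommGroup T] [Module ℂ T] [TopologicalSpace T]
    [NormedAddCommGroup h] [InnerProductSpace ℂ h] where
  emb : T →L[ℂ] h
  injective : Function.Injective emb
  dense : DenseRange emb

namespace GelfandTriple

variable {T h : Type*} [AddCommGroup T] [Module ℂ T] [TopologicalSpace T]
  [NormedAddCommGroup h] [InnerProductSpace ℂ h] (G : GelfandTriple T h)

/-- The duality bracket `⟨g, f⟩ = conj (g(f))`, linear in `f`. -/
def bracket (g : T →L⋆[ℂ] ℂ) : T →ₗ[ℂ] ℂ where
  toFun f := starRingEnd ℂ (g f)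
  map_add' f f' := by simp
  map_smul' c f := by simp

/-- The embedding `h ⊆ T'`, so that `⟨u, f⟩ = ⟨u, f⟩_h` for `u ∈ h` and `f ∈ T`. -/
def toAntidual (u : h) : T →L⋆[ℂ] ℂ :=
  ((innerSL ℂ).flip u).comp G.emb

theorem bracket_toAntidual (u : h) (f : T) :
    bracket (G.toAntidual u) f = inner ℂ u (G.emb f) := by
  simp [bracket, toAntidual]

/-- The singular dressing `e^{a(g)}`, with values regarded as finite particle vectors over `h`. -/
def dress (g : T →L⋆[ℂ] ℂ) : FinFock T →ₗ[ℂ] FinFock h :=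
  FinFock.map G.emb.toLinearMap ∘ₗ expAnnihilate (bracket g)

/-- The finite particle vectors over `T` with the inner product
`⟨Ψ, Φ⟩_g = ⟨e^{a(g)} Ψ, e^{a(g)} Φ⟩`. -/
def PreFock (_G : GelfandTriple T h) (_g : T →L⋆[ℂ] ℂ) : Type _ := FinFock T

instance (g : T →L⋆[ℂ] ℂ) : AddCommGroup (G.PreFock g) := inferInstanceAs (AddCommGroup (FinFock T))
instance (g : T →L⋆[ℂ] ℂ) : Module ℂ (G.PreFock g) := inferInstanceAs (Module ℂ (FinFock T))

/-- The renormalized inner product. -/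
@[reducible]
def preFockCore (g : T →L⋆[ℂ] ℂ) : PreInnerProductSpace.Core ℂ (G.PreFock g) where
  inner Ψ Φ := inner ℂ (G.dress g Ψ) (G.dress g Φ)
  conj_inner_symm Ψ Φ := inner_conj_symm _ _
  re_inner_nonneg Ψ := inner_self_nonneg (𝕜 := ℂ)
  add_left Ψ Ψ' Φ := by
    rw [← inner_add_left]; exact congr_arg (fun x => inner ℂ x _) (map_add (G.dress g) Ψ Ψ')
  smul_left Ψ Φ c := by
    rw [← inner_smul_left]; exact congr_arg (fun x => inner ℂ x _) (map_smul (G.dress g) c Ψ)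

instance (g : T →L⋆[ℂ] ℂ) : SeminormedAddCommGroup (G.PreFock g) :=
  @InnerProductSpace.Core.toSeminormedAddCommGroup ℂ (G.PreFock g) _ _ _ (G.preFockCore g)

instance (g : T →L⋆[ℂ] ℂ) : InnerProductSpace ℂ (G.PreFock g) :=
  InnerProductSpace.ofCore (G.preFockCore g)

/-- The `g`-renormalized Hilbert space `F_g`. -/
abbrev RenFock (g : T →L⋆[ℂ] ℂ) : Type _ := Completion (G.PreFock g)

/-- The canonical map of `F_fin(T)` onto a dense subspace of `F_g`. -/
def toRenFock (g : T →L⋆[ℂ] ℂ) : FinFock T →ₗ[ℂ] G.RenFock g :=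
  (Completion.toComplₗᵢ (𝕜 := ℂ) (E := G.PreFock g)).toLinearMap

theorem denseRange_toRenFock (g : T →L⋆[ℂ] ℂ) : DenseRange (G.toRenFock g) :=
  Completion.denseRange_coe (α := G.PreFock g)

theorem norm_toRenFock (g : T →L⋆[ℂ] ℂ) (Ψ : FinFock T) :
    ‖G.toRenFock g Ψ‖ = ‖G.dress g Ψ‖ := by
  have h1 : ‖G.toRenFock g Ψ‖ = ‖(show G.PreFock g from Ψ)‖ :=
    Completion.norm_coe (E := G.PreFock g) Ψ
  rw [h1, ← sq_eq_sq₀ (norm_nonneg _) (norm_nonneg _), InnerProductSpace.norm_sq_eq_re_inner (𝕜 := ℂ),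
    InnerProductSpace.norm_sq_eq_re_inner (𝕜 := ℂ)]
  rfl

/-- The dressing unitary `U_{g,g'} : F_g → F_{g'}`, the continuous extension of
`Ψ ↦ e^{a(g - g')} Ψ` on `F_fin(T)`. -/
def dressing (g g' : T →L⋆[ℂ] ℂ) : G.RenFock g ≃ₗᵢ[ℂ] G.RenFock g' :=
  (expAnnihilateEquiv (bracket (g - g'))).extendOfIsometry (G.toRenFock g) (G.toRenFock g')
    (G.denseRange_toRenFock g) (G.denseRange_toRenFock g') (by
      intro Ψ
      rw [norm_toRenFock, norm_toRenFock]
      have hb : bracket g' + bracket (g - g') = bracket g := by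
        ext f; simp [bracket]
      have := LinearMap.congr_fun (expAnnihilate_comp (bracket g') (bracket (g - g'))) Ψ
      rw [hb] at this
      change ‖FinFock.map G.emb.toLinearMap ((expAnnihilate (bracket g') ∘ₗ
        expAnnihilate (bracket (g - g'))) Ψ)‖ = _
      rw [this]
      rfl)

/-- The dressing unitary `U_{g,0} : F_g → F_0 = F(h)`, the continuous extension of
`Ψ ↦ e^{a(g)} Ψ` on `F_fin(T)`. -/
def dressingToFock (g : T →L⋆[ℂ] ℂ) : G.RenFock g ≃ₗᵢ[ℂ] FockSpace h :=
  (expAnnihilateEquiv (bracket g)).extendOfIsometry (G.toRenFock g)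
    ((Completion.toComplₗᵢ (𝕜 := ℂ) (E := FinFock h)).toLinearMap ∘ₗ
      FinFock.map G.emb.toLinearMap)
    (G.denseRange_toRenFock g)
    (Completion.denseRange_coe.comp (denseRange_map _ G.dense) (Completion.continuous_coe _))
    (fun Ψ => by
      rw [norm_toRenFock]
      exact Completion.norm_coe _)

/-- The free fields and conjugate momenta on the Fock space `F(h)`. -/
def fockFields : FieldOperators T (FockSpace h) where
  φ f := fockField (G.emb f)
  π f := fockMomentum (G.emb f)

/-- The interacting fields and conjugate momenta on `F_g`:
`φ_g(f) = U_{0,g} (φ₀(f) + √2 Re⟨g, f⟩) U_{g,0}` and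
`π_g(f) = U_{0,g} (π₀(f) + √2 Im⟨g, f⟩) U_{g,0}`. -/
def fields (g : T →L⋆[ℂ] ℂ) : FieldOperators T (G.RenFock g) where
  φ f := sandwich (G.dressingToFock g).symm
    (addScalar (fockField (G.emb f)) (Real.sqrt 2 * (bracket g f).re : ℝ)) (G.dressingToFock g)
  π f := sandwich (G.dressingToFock g).symm
    (addScalar (fockMomentum (G.emb f)) (Real.sqrt 2 * (bracket g f).im : ℝ)) (G.dressingToFock g)

end GelfandTriple

end VanHove

end

noncomputable section

namespace VanHove

/-! ### The canonical commutation relations on algebraic symmetric tensors. -/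

section Commutation

variable {E : Type*} [AddCommGroup E] [Module ℂ E]

/-! Everything is transported to the single space F(h). There `(G.fields g).φ f` becomes the free
field plus the number √2 Re⟨g, f⟩ (`mem_fields_graph`). Since a†(f) is linear and a(f) antilinear in
f, each momentum is a field at the test function -i f, so only the fields need study. Part 1 is then
the cocycle identity U_{g',0} U_{g,g'} = U_{g,0} (`dressingToFock_dressing`), which follows from the
group law of e^{a(g)}, together with the splitting g = (g - g') + g'.

Parts 2 and 3 ask when a bounded operator S ≠ 0 can intertwine the free fields with the fields
shifted by √2 Re⟨g, f⟩. Choose finite particle vectors Φ, Ψ with ⟨Φ, S Ψ⟩ ≠ 0. The intertwining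
relation gives c(f) ⟨Φ, S Ψ⟩ = ⟨φ₀(f) Φ, S Ψ⟩ - ⟨Φ, S φ₀(f) Ψ⟩, where c(f) is the shift. With Φ and
Ψ fixed, the right side is at most a constant times ‖f‖ (`exists_shift_le`). Applied to f and to -i
f, this bounds ⟨g, f⟩ in the norm of h, so g ∈ h by Riesz. Unitarity of S plays no role, so the same
argument proves disjointness and the necessity of g - g' ∈ h.

Conversely, for u = g - g' ∈ h the Weyl operator exp(a†(u) - a(u)) implements the shift. It is
defined by its power series on finite particle vectors, which converges because k factors acting on
an n-particle vector cost at most (2‖u‖)^k √((n+1)⋯(n+k)). Skew-symmetry of the generator makes it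
isometric (`inner_weylFin`), and its adjoint is the Weyl operator of -u, whence unitarity. The
commutator of φ₀(f) with the generator is the number √2 Re⟨u, f⟩, and closedness of the field's
graph carries the resulting shift from the partial sums to the limit (`weyl_mem_fockField_graph`).
-/

theorem coe_symmetrizer {n : ℕ} (x : ⨂[ℂ]^n E) :
    (symmetrizer n x : ⨂[ℂ]^n E) = ((n.factorial : ℂ)⁻¹) • ∑ σ : Equiv.Perm (Fin n), permute n σ x := by
  change (((n.factorial : ℂ)⁻¹) • ∑ σ : Equiv.Perm (Fin n), permute n σ) x = _
  simp only [LinearMap.smul_apply, LinearMap.sum_apply]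

theorem symmetrizer_permute {n : ℕ} (τ : Equiv.Perm (Fin n)) (x : ⨂[ℂ]^n E) :
    symmetrizer n (permute n τ x) = symmetrizer n x := by
  apply Subtype.ext
  rw [coe_symmetrizer, coe_symmetrizer]
  congr 1
  refine Fintype.sum_equiv (Equiv.mulRight τ) _ _ fun σ => ?_
  rw [Equiv.coe_mulRight, permute_mul]; rfl

/-- A permutation of n + 1 letters is a permutation of the last n followed by a transposition with
0. This decomposition organizes the sum in the symmetrizer. -/
theorem permute_prepend {n : ℕ} (f : E) (i : Fin (n + 1)) (σ : Equiv.Perm (Fin n)) (x : ⨂[ℂ]^n E) :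
    permute (n + 1) (Equiv.Perm.decomposeFin.symm (i, σ)) (prepend n f x)
      = permute (n + 1) (Equiv.swap 0 i) (prepend n f (permute n σ x)) := by
  have h : permute (n + 1) (Equiv.Perm.decomposeFin.symm (i, σ)) ∘ₗ prepend n f
      = permute (n + 1) (Equiv.swap 0 i) ∘ₗ prepend n f ∘ₗ permute n σ := by
    ext k
    simp only [LinearMap.compMultilinearMap_apply, LinearMap.comp_apply, permute_tprod,
      prepend_tprod]
    congr 1
    funext j
    have key : ∀ m : Fin (n + 1), (Fin.cons f k : Fin (n + 1) → E) m
        = (Fin.cons f (fun i => k (σ.symm i)) : Fin (n + 1) → E)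
          (Equiv.swap 0 i (Equiv.Perm.decomposeFin.symm (i, σ) m)) := by
      intro m
      induction m using Fin.cases with
      | zero => simp
      | succ m =>
        simp only [Equiv.Perm.decomposeFin_symm_apply_succ, Equiv.swap_apply_self, Fin.cons_succ]
        exact congrArg k (σ.symm_apply_apply m).symm
    rw [key]
    simp
  exact LinearMap.congr_fun h x

theorem symmetrizer_prepend_permute {n : ℕ} (f : E) (σ : Equiv.Perm (Fin n)) (x : ⨂[ℂ]^n E) :
    symmetrizer (n + 1) (prepend n f (permute n σ x)) = symmetrizer (n + 1) (prepend n f x) := by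
  have h := permute_prepend f 0 σ x
  rw [← symmetrizer_permute (Equiv.swap 0 0) (prepend n f (permute n σ x)), ← h,
    symmetrizer_permute]

theorem symmetrizer_prepend_symmetrizer {n : ℕ} (f : E) (x : ⨂[ℂ]^n E) :
    symmetrizer (n + 1) (prepend n f (symmetrizer n x)) = symmetrizer (n + 1) (prepend n f x) := by
  have hf : (n.factorial : ℂ) ≠ 0 := by exact_mod_cast n.factorial_ne_zero
  simp only [coe_symmetrizer, map_smul, map_sum, symmetrizer_prepend_permute, Finset.sum_const,
    Finset.card_univ, Fintype.card_perm, Fintype.card_fin]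
  rw [← Nat.cast_smul_eq_nsmul ℂ, smul_smul, inv_mul_cancel₀ hf, one_smul]

theorem prepend_prepend_swap {n : ℕ} (f u : E) (x : ⨂[ℂ]^n E) :
    prepend (n + 1) f (prepend n u x)
      = permute (n + 1 + 1) (Equiv.swap 0 1) (prepend (n + 1) u (prepend n f x)) := by
  have h : prepend (n + 1) f ∘ₗ prepend n u
      = permute (n + 1 + 1) (Equiv.swap 0 1) ∘ₗ prepend (n + 1) u ∘ₗ prepend n f := by
    ext k
    simp only [LinearMap.compMultilinearMap_apply, LinearMap.comp_apply, permute_tprod,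
      prepend_tprod, Equiv.symm_swap]
    congr 1
    funext j
    induction j using Fin.cases with
    | zero => rw [Equiv.swap_apply_left]; rfl
    | succ j =>
      induction j using Fin.cases with
      | zero => rw [Fin.succ_zero_eq_one, Equiv.swap_apply_right]; rfl
      | succ j =>
        have e : Equiv.swap (0 : Fin (n + 1 + 1)) 1 j.succ.succ = j.succ.succ :=
          Equiv.swap_apply_of_ne_of_ne (Fin.succ_ne_zero _)
            (fun h => Fin.succ_ne_zero j (Fin.succ_injective _ h))
        rw [e]
        rfl
  exact LinearMap.congr_fun h x

theorem create_single (f : E) (n : ℕ) (x : symTensor n E) :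
    create f (FinFock.single n x) = FinFock.single (n + 1)
      ((Real.sqrt (n + 1) : ℂ) • symmetrizer (n + 1) (prepend n f (x : ⨂[ℂ]^n E))) := by
  rw [create, FinFock.lift_single]; rfl

/-- The two orders differ by a transposition of the first two factors, which the outer symmetrizer
absorbs; the inner symmetrizer is redundant. -/
theorem create_commute (f u : E) : Commute (create f) (create u) := by
  refine FinFock.ext fun n x => ?_
  simp only [Module.End.mul_apply, create_single, map_smul,
    symmetrizer_prepend_symmetrizer]
  rw [prepend_prepend_swap, symmetrizer_permute]

/-- Symmetrizing `f ⊗ x` with `x` symmetric amounts to averaging over the position of `f`. -/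
theorem symmetrizer_prepend {n : ℕ} (f : E) (x : symTensor n E) :
    ((n + 1 : ℕ) : ℂ) • (symmetrizer (n + 1) (prepend n f (x : ⨂[ℂ]^n E)) : ⨂[ℂ]^(n + 1) E)
      = ∑ i : Fin (n + 1), permute (n + 1) (Equiv.swap 0 i) (prepend n f (x : ⨂[ℂ]^n E)) := by
  have hf : (n.factorial : ℂ) ≠ 0 := by exact_mod_cast n.factorial_ne_zero
  have hn : ((n + 1 : ℕ) : ℂ) ≠ 0 := by exact_mod_cast n.succ_ne_zero
  have hx : ∀ σ : Equiv.Perm (Fin n), permute n σ (x : ⨂[ℂ]^n E) = x := x.2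
  -- For each position i of f there are n! permutations of the tail, all fixing the symmetric tensor
  -- x. So (n + 1) · n! / (n + 1)! leaves coefficient 1.
  rw [coe_symmetrizer, ← Equiv.Perm.decomposeFin.symm.sum_comp, Fintype.sum_prod_type]
  simp only [permute_prepend, hx, Finset.sum_const, Finset.card_univ, Fintype.card_perm,
    Fintype.card_fin, ← Nat.cast_smul_eq_nsmul ℂ]
  rw [← Finset.smul_sum, smul_smul, smul_smul, Nat.factorial_succ, Nat.cast_mul]
  convert one_smul ℂ _ using 2
  field_simp

theorem contract_prepend {n : ℕ} (ℓ : E →ₗ[ℂ] ℂ) (u : E) (x : ⨂[ℂ]^n E) :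
    contract n ℓ (prepend n u x) = ℓ u • x := by
  have h : contract n ℓ ∘ₗ prepend n u = ℓ u • LinearMap.id := by
    ext k
    simp only [LinearMap.compMultilinearMap_apply, LinearMap.comp_apply,
      prepend_tprod, contract_tprod]
    rfl
  exact LinearMap.congr_fun h x

/-- With u in slot j + 1, the contraction hits the j-th factor of x rather than u. Removing that
factor first and inserting u in its place gives the same tensor; this is where a†(u) a(ℓ) emerges in
the commutation relation. -/
theorem contract_swap_prepend {n : ℕ} (ℓ : E →ₗ[ℂ] ℂ) (u : E) (j : Fin (n + 1))
    (x : ⨂[ℂ]^(n + 1) E) :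
    contract (n + 1) ℓ (permute (n + 1 + 1) (Equiv.swap 0 j.succ) (prepend (n + 1) u x))
      = permute (n + 1) (Equiv.swap 0 j)
          (prepend n u (contract n ℓ (permute (n + 1) (Equiv.swap 0 j) x))) := by
  have h : contract (n + 1) ℓ ∘ₗ permute (n + 1 + 1) (Equiv.swap 0 j.succ) ∘ₗ prepend (n + 1) u
      = permute (n + 1) (Equiv.swap 0 j) ∘ₗ prepend n u ∘ₗ contract n ℓ ∘ₗ
        permute (n + 1) (Equiv.swap 0 j) := by
    ext k
    simp only [LinearMap.compMultilinearMap_apply, LinearMap.comp_apply, permute_tprod,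
      prepend_tprod, contract_tprod, map_smul, Equiv.symm_swap]
    rw [Equiv.swap_apply_left, Equiv.swap_apply_left, Fin.cons_succ]
    congr 2
    funext i
    by_cases hi : i = j
    · subst hi
      rw [Equiv.swap_apply_right, Equiv.swap_apply_right]; rfl
    · rw [Equiv.swap_apply_of_ne_of_ne (Fin.succ_ne_zero _)
        (fun h => hi (Fin.succ_injective _ h)), Fin.cons_succ]
      by_cases h0 : i = 0
      · subst h0
        rw [Equiv.swap_apply_left]
        obtain ⟨m, rfl⟩ := Fin.exists_succ_eq.2 (Ne.symm hi)
        rw [Fin.cons_succ, Equiv.swap_apply_right]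
      · rw [Equiv.swap_apply_of_ne_of_ne h0 hi]
        obtain ⟨m, rfl⟩ := Fin.exists_succ_eq.2 h0
        rw [Fin.cons_succ, Equiv.swap_apply_of_ne_of_ne h0 hi]
  exact LinearMap.congr_fun h x

theorem sqrt_succ_mul_self (n : ℕ) :
    (Real.sqrt (n + 1) : ℂ) * (Real.sqrt (n + 1) : ℂ) = ((n + 1 : ℕ) : ℂ) := by
  rw [← Complex.ofReal_mul, Real.mul_self_sqrt (by positivity)]
  push_cast; rfl

/-- The canonical commutation relation `a(ℓ) a†(u) = a†(u) a(ℓ) + ℓ(u)`. -/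
theorem annihilate_mul_create (ℓ : E →ₗ[ℂ] ℂ) (u : E) :
    annihilate ℓ * create u = create u * annihilate ℓ + ℓ u • 1 := by
  refine FinFock.ext fun n x => ?_
  have h1 : (annihilate ℓ * create u) (FinFock.single n x) = FinFock.single n
      (((n + 1 : ℕ) : ℂ) •
        symContract n ℓ (symmetrizer (n + 1) (prepend n u (x : ⨂[ℂ]^n E)))) := by
    rw [Module.End.mul_apply, create_single, annihilate_single_succ, map_smul (symContract n ℓ), smul_smul,
      sqrt_succ_mul_self]
  -- The factor n + 1 from the two square roots cancels the average over the position of u. The term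
  -- with u in front gives ℓ(u) x; the others contract a factor of x.
  have h2 : ((((n + 1 : ℕ) : ℂ) •
        symContract n ℓ (symmetrizer (n + 1) (prepend n u (x : ⨂[ℂ]^n E))) : symTensor n E)
          : ⨂[ℂ]^n E)
      = ℓ u • (x : ⨂[ℂ]^n E) + ∑ i : Fin n, contract n ℓ
        (permute (n + 1) (Equiv.swap 0 i.succ) (prepend n u (x : ⨂[ℂ]^n E))) := by
    change ((n + 1 : ℕ) : ℂ) • contract n ℓ
      (symmetrizer (n + 1) (prepend n u (x : ⨂[ℂ]^n E)) : ⨂[ℂ]^(n + 1) E) = _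
    rw [← map_smul, symmetrizer_prepend, map_sum, Fin.sum_univ_succ, Equiv.swap_self]
    congr 1
    rw [← contract_prepend ℓ u]
    congr 1
    exact LinearMap.congr_fun
      (f := permute (n + 1) (Equiv.refl _)) (g := LinearMap.id) (by simp [permute]) _
  rw [h1, LinearMap.add_apply, LinearMap.smul_apply, Module.End.one_apply, ← map_smul (FinFock.single n)]
  match n, x, h2 with
  | 0, x, h2 =>
    rw [Module.End.mul_apply, annihilate_single_zero, map_zero,
      zero_add (FinFock.single 0 _)]
    congr 1
    apply Subtype.ext
    rw [h2]; simp
  | n + 1, x, h2 =>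
    rw [Module.End.mul_apply, annihilate_single_succ, create_single, ← map_add]
    congr 1
    apply Subtype.ext
    rw [h2, add_comm (ℓ u • _)]
    have hx : ∀ σ : Equiv.Perm (Fin (n + 1)), permute (n + 1) σ (x : ⨂[ℂ]^(n + 1) E) = x := x.2
    simp only [contract_swap_prepend, hx, Submodule.coe_add, Submodule.coe_smul, map_smul,
      smul_smul, sqrt_succ_mul_self]
    congr 1
    exact (symmetrizer_prepend u (symContract n ℓ x)).symm

end Commutation

/-! ### Norm bounds for creation and annihilation on n-particle vectors. -/

section Bounds

variable {h : Type*} [NormedAddCommGroup h] [InnerProductSpace ℂ h]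

/-- Cauchy–Schwarz needs only positive semidefiniteness, so a local `PreInnerProductSpace.Core` on
all tensors suffices. -/
theorem norm_tensorInner_sq_le {n : ℕ} (x y : ⨂[ℂ]^n h) :
    ‖tensorInner n x y‖ ^ 2 ≤ (tensorInner n x x).re * (tensorInner n y y).re := by
  let c : PreInnerProductSpace.Core ℂ (⨂[ℂ]^n h) :=
    { inner := fun x y => tensorInner n x y
      conj_inner_symm := tensorInner_conj_symm
      re_inner_nonneg := tensorInner_self_nonneg
      add_left := fun x y z => by simp
      smul_left := fun x y r => by simp }
  have := @InnerProductSpace.Core.inner_mul_inner_self_le ℂ (⨂[ℂ]^n h) _ _ _ c x y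
  change ‖tensorInner n x y‖ * ‖tensorInner n y x‖ ≤ _ at this
  rw [← tensorInner_conj_symm y x, RCLike.norm_conj, ← sq] at this
  exact this

/-- Extracts a bound from Cauchy–Schwarz estimates of the form a² ≤ a b, where a may vanish. -/
theorem le_of_sq_le_mul {a b : ℝ} (ha : 0 ≤ a) (hb : 0 ≤ b) (h : a ^ 2 ≤ a * b) : a ≤ b := by
  rcases ha.eq_or_lt with rfl | h0
  · exact hb
  · exact le_of_mul_le_mul_left (by rwa [sq] at h) h0

theorem tensorInner_self_ofReal {n : ℕ} (x : ⨂[ℂ]^n h) :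
    ((tensorInner n x x).re : ℂ) = tensorInner n x x :=
  Complex.conj_eq_iff_re.1 (tensorInner_conj_symm x x)

theorem re_tensorInner_self_eq_norm {n : ℕ} (x : ⨂[ℂ]^n h) :
    (tensorInner n x x).re = ‖tensorInner n x x‖ := by
  rw [← tensorInner_self_ofReal, Complex.norm_real, Complex.ofReal_re,
    Real.norm_of_nonneg (tensorInner_self_nonneg x)]

/-- The symmetrizer P is an orthogonal projection: ⟨Px, Px⟩ = ⟨Px, x⟩, and Cauchy–Schwarz applies.
-/
theorem tensorInner_symmetrizer_le {n : ℕ} (x : ⨂[ℂ]^n h) :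
    (tensorInner n (symmetrizer n x : ⨂[ℂ]^n h) (symmetrizer n x : ⨂[ℂ]^n h)).re
      ≤ (tensorInner n x x).re := by
  refine le_of_sq_le_mul (tensorInner_self_nonneg _) (tensorInner_self_nonneg _) ?_
  have := norm_tensorInner_sq_le (symmetrizer n x : ⨂[ℂ]^n h) x
  rwa [← tensorInner_symmetrizer, ← re_tensorInner_self_eq_norm] at this

theorem tensorInner_prepend_prepend {n : ℕ} (f : h) (x y : ⨂[ℂ]^n h) :
    tensorInner (n + 1) (prepend n f x) (prepend n f y) = (‖f‖ : ℂ) ^ 2 * tensorInner n x y := by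
  rw [tensorInner_prepend, contract_prepend, innerₛₗ_apply_apply, LinearMap.map_smulₛₗ,
    LinearMap.smul_apply, inner_self_eq_norm_sq_to_K, smul_eq_mul]
  simp

theorem tensorInner_prepend_self {n : ℕ} (f : h) (x : ⨂[ℂ]^n h) :
    (tensorInner (n + 1) (prepend n f x) (prepend n f x)).re
      = ‖f‖ ^ 2 * (tensorInner n x x).re := by
  rw [tensorInner_prepend_prepend, ← Complex.ofReal_pow, Complex.re_ofReal_mul]

/-- Contraction with f is adjoint to prepending f, which multiplies norms by exactly ‖f‖. -/
theorem tensorInner_contract_le {n : ℕ} (f : h) (x : ⨂[ℂ]^(n + 1) h) :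
    (tensorInner n (contract n (innerₛₗ ℂ f) x) (contract n (innerₛₗ ℂ f) x)).re
      ≤ ‖f‖ ^ 2 * (tensorInner (n + 1) x x).re := by
  refine le_of_sq_le_mul (tensorInner_self_nonneg _)
    (mul_nonneg (sq_nonneg _) (tensorInner_self_nonneg _)) ?_
  have := norm_tensorInner_sq_le x (prepend n f (contract n (innerₛₗ ℂ f) x))
  rw [tensorInner_prepend, ← re_tensorInner_self_eq_norm, tensorInner_prepend_self] at this
  linarith

theorem FinFock.norm_single_sq (n : ℕ) (x : symTensor n h) :
    ‖FinFock.single n x‖ ^ 2 = (tensorInner n (x : ⨂[ℂ]^n h) x).re := by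
  rw [FinFock.norm_sq, finInner_single_single]

/-- Keeping the image homogeneous lets the bound be iterated, with the degree tracked at each step.
-/
theorem exists_create_single (f : h) (n : ℕ) (x : symTensor n h) :
    ∃ y, create f (FinFock.single n x) = FinFock.single (n + 1) y ∧
      ‖FinFock.single (n + 1) y‖ ≤ Real.sqrt (n + 1) * ‖f‖ * ‖FinFock.single n x‖ := by
  refine ⟨_, create_single f n x, ?_⟩
  rw [map_smul, norm_smul, Complex.norm_real, Real.norm_of_nonneg (Real.sqrt_nonneg _), mul_assoc]
  refine mul_le_mul_of_nonneg_left ?_ (Real.sqrt_nonneg _)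
  refine (pow_le_pow_iff_left₀ (norm_nonneg _) (by positivity) two_ne_zero).1 ?_
  rw [mul_pow, FinFock.norm_single_sq, FinFock.norm_single_sq, ← tensorInner_prepend_self]
  exact tensorInner_symmetrizer_le _

theorem exists_ann_single_succ (f : h) (n : ℕ) (x : symTensor (n + 1) h) :
    ∃ y, ann f (FinFock.single (n + 1) x) = FinFock.single n y ∧
      ‖FinFock.single n y‖ ≤ Real.sqrt (n + 1) * ‖f‖ * ‖FinFock.single (n + 1) x‖ := by
  refine ⟨_, annihilate_single_succ _ n x, ?_⟩
  rw [map_smul, norm_smul, Complex.norm_real, Real.norm_of_nonneg (Real.sqrt_nonneg _), mul_assoc]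
  refine mul_le_mul_of_nonneg_left ?_ (Real.sqrt_nonneg _)
  refine (pow_le_pow_iff_left₀ (norm_nonneg _) (by positivity) two_ne_zero).1 ?_
  rw [mul_pow, FinFock.norm_single_sq, FinFock.norm_single_sq]
  exact tensorInner_contract_le f _

end Bounds

/-! ### Dependence of a and a† on scalar multiples of their arguments. -/

section Homogeneity

variable {E : Type*} [AddCommGroup E] [Module ℂ E]

theorem contract_smul {n : ℕ} (c : ℂ) (ℓ : E →ₗ[ℂ] ℂ) : contract n (c • ℓ) = c • contract n ℓ := by
  ext f
  simp only [LinearMap.compMultilinearMap_apply, LinearMap.smul_apply, contract_tprod, smul_assoc]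

theorem prepend_smul {n : ℕ} (c : ℂ) (f : E) : prepend n (c • f) = c • prepend n f := by
  ext k
  simp only [LinearMap.compMultilinearMap_apply, LinearMap.smul_apply, prepend, PiTensorProduct.lift.tprod,
    map_smul]

theorem annihilate_smul (c : ℂ) (ℓ : E →ₗ[ℂ] ℂ) : annihilate (c • ℓ) = c • annihilate ℓ := by
  refine FinFock.ext fun n x => ?_
  rw [LinearMap.smul_apply]
  match n, x with
  | 0, x => simp only [annihilate_single_zero, smul_zero]
  | n + 1, x =>
    simp only [annihilate_single_succ, map_smul]
    rw [smul_comm c]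
    congr 1
    rw [← map_smul]
    congr 1
    apply Subtype.ext
    change contract n (c • ℓ) x = c • contract n ℓ x
    rw [contract_smul, LinearMap.smul_apply]

theorem create_smul (c : ℂ) (f : E) : create (c • f) = c • create f := by
  refine FinFock.ext fun n x => ?_
  rw [LinearMap.smul_apply, create_single, create_single, prepend_smul]
  simp only [LinearMap.smul_apply, map_smul]
  rw [smul_comm c]

end Homogeneity

/-! ### Momenta as rotated fields, and Weyl operators. -/

section Weyl

variable {h : Type*} [NormedAddCommGroup h] [InnerProductSpace ℂ h]

theorem ann_smul (c : ℂ) (f : h) : ann (c • f) = starRingEnd ℂ c • ann f := by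
  rw [ann, LinearMap.map_smulₛₗ, annihilate_smul, ann]

/-- Linearity of a† and antilinearity of a turn a† + a at -i f into -i (a† - a) at f. Every
statement about momenta thereby reduces to one about fields. -/
theorem finMomentum_eq_finField (f : h) : finMomentum f = finField (-Complex.I • f) := by
  rw [finMomentum, finField, create_smul, ann_smul, mul_inv, mul_comm, mul_smul, Complex.inv_I,
    map_neg, Complex.conj_I, neg_neg, smul_sub, sub_eq_add_neg, neg_smul Complex.I (ann f), neg_neg]

theorem fockMomentum_eq_fockField (f : h) : fockMomentum f = fockField (-Complex.I • f) := by
  rw [fockMomentum, finMomentum_eq_finField, fockField]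

/-! ### Fields on a fixed vector, bounded in the test vector. -/

section FieldBounds

theorem exists_norm_create_le (Ψ : FinFock h) : ∃ C : ℝ, ∀ f : h, ‖create f Ψ‖ ≤ C * ‖f‖ := by
  induction Ψ using FinFock.induction with
  | h0 => exact ⟨0, fun f => by simp⟩
  | hs n x =>
    refine ⟨Real.sqrt (n + 1) * ‖FinFock.single n x‖, fun f => ?_⟩
    obtain ⟨y, hy, hb⟩ := exists_create_single f n x
    rw [hy]
    linarith
  | ha Ψ Φ h1 h2 =>
    obtain ⟨C, hC⟩ := h1
    obtain ⟨D, hD⟩ := h2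
    refine ⟨C + D, fun f => ?_⟩
    rw [map_add, add_mul]
    exact (norm_add_le _ _).trans (add_le_add (hC f) (hD f))

theorem exists_norm_ann_le (Ψ : FinFock h) : ∃ C : ℝ, ∀ f : h, ‖ann f Ψ‖ ≤ C * ‖f‖ := by
  induction Ψ using FinFock.induction with
  | h0 => exact ⟨0, fun f => by simp⟩
  | hs n x =>
    match n, x with
    | 0, x => exact ⟨0, fun f => by rw [ann, annihilate_single_zero]; simp⟩
    | n + 1, x =>
      refine ⟨Real.sqrt (n + 1) * ‖FinFock.single (n + 1) x‖, fun f => ?_⟩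
      obtain ⟨y, hy, hb⟩ := exists_ann_single_succ f n x
      rw [hy]
      linarith
  | ha Ψ Φ h1 h2 =>
    obtain ⟨C, hC⟩ := h1
    obtain ⟨D, hD⟩ := h2
    refine ⟨C + D, fun f => ?_⟩
    rw [map_add, add_mul]
    exact (norm_add_le _ _).trans (add_le_add (hC f) (hD f))

/-- The constant depends on Ψ but not on f, which is what the shift estimate needs. -/
theorem exists_norm_finField_le (Ψ : FinFock h) :
    ∃ C : ℝ, ∀ f : h, ‖finField f Ψ‖ ≤ C * ‖f‖ := by
  obtain ⟨C, hC⟩ := exists_norm_create_le Ψ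
  obtain ⟨D, hD⟩ := exists_norm_ann_le Ψ
  refine ⟨‖(Real.sqrt 2 : ℂ)⁻¹‖ * (C + D), fun f => ?_⟩
  rw [finField, LinearMap.smul_apply, norm_smul, mul_assoc, LinearMap.add_apply, add_mul]
  gcongr
  exact (norm_add_le _ _).trans (add_le_add (hC f) (hD f))

end FieldBounds

/-! ### The Weyl operator as an exponential series. -/

section Displacement

/-- The generator `a†(u) - a(u)` of displacements. -/
def displacement (u : h) : FinFock h →ₗ[ℂ] FinFock h := create u - ann u

theorem displacement_neg (u : h) : displacement (-u) = -displacement u := by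
  rw [← neg_one_smul ℂ u, displacement, create_smul, ann_smul, displacement]
  simp
  abel

theorem inner_displacement (u : h) (Ψ Φ : FinFock h) :
    inner ℂ (displacement u Ψ) Φ = -inner ℂ Ψ (displacement u Φ) := by
  have h1 : inner ℂ Ψ (create u Φ) = inner ℂ (ann u Ψ) Φ := finInner_create u Ψ Φ
  have h2 : inner ℂ (create u Ψ) Φ = inner ℂ Ψ (ann u Φ) := by
    rw [← inner_conj_symm, ← inner_conj_symm Ψ]
    exact congrArg _ (finInner_create u Φ Ψ)
  simp only [displacement, LinearMap.sub_apply, inner_sub_left, inner_sub_right, h1, h2]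
  ring

theorem inner_displacement_pow (u : h) (k : ℕ) (Ψ Φ : FinFock h) :
    inner ℂ ((displacement u ^ k) Ψ) Φ = (-1) ^ k * inner ℂ Ψ ((displacement u ^ k) Φ) := by
  induction k generalizing Ψ with
  | zero => simp
  | succ k ih =>
    rw [pow_succ, Module.End.mul_apply, ih, inner_displacement, ← Module.End.mul_apply,
      ← pow_succ', ← pow_succ, pow_succ (-1 : ℂ)]
    ring

/-- Expanding the power gives 2^k words in a†(u) and a(u). The degree rises by at most one per
letter, so a†(u)^k is the worst case, with product √(n+1) ⋯ √(n+k). -/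
theorem norm_displacement_pow_single_le (u : h) (k : ℕ) : ∀ (n : ℕ) (x : symTensor n h),
    ‖(displacement u ^ k) (FinFock.single n x)‖
      ≤ (2 * ‖u‖) ^ k * Real.sqrt ((n + 1).ascFactorial k) * ‖FinFock.single n x‖ := by
  induction k with
  | zero => intro n x; simp
  | succ k ih =>
    intro n x
    have hasc : Real.sqrt ((n + 1).ascFactorial (k + 1))
        = Real.sqrt (n + 1) * Real.sqrt ((n + 2).ascFactorial k) := by
      rw [← Real.sqrt_mul (by positivity), Nat.ascFactorial_succ, ← Nat.succ_ascFactorial]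
      push_cast; rfl
    have h1 : ‖(displacement u ^ k) (create u (FinFock.single n x))‖
        ≤ (2 * ‖u‖) ^ k * ‖u‖ * Real.sqrt ((n + 1).ascFactorial (k + 1)) * ‖FinFock.single n x‖ := by
      obtain ⟨y, hy, hb⟩ := exists_create_single u n x
      rw [hy, hasc]
      calc _ ≤ (2 * ‖u‖) ^ k * Real.sqrt ((n + 2).ascFactorial k) * ‖FinFock.single (n + 1) y‖ :=
            ih (n + 1) y
        _ ≤ (2 * ‖u‖) ^ k * Real.sqrt ((n + 2).ascFactorial k) *
            (Real.sqrt (n + 1) * ‖u‖ * ‖FinFock.single n x‖) := by gcongr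
        _ = _ := by ring
    have h2 : ‖(displacement u ^ k) (ann u (FinFock.single n x))‖
        ≤ (2 * ‖u‖) ^ k * ‖u‖ * Real.sqrt ((n + 1).ascFactorial (k + 1)) * ‖FinFock.single n x‖ := by
      match n, x, hasc with
      | 0, x, _ =>
        rw [ann, annihilate_single_zero, map_zero, norm_zero]
        positivity
      | n + 1, x, hasc =>
        obtain ⟨y, hy, hb⟩ := exists_ann_single_succ u n x
        rw [hy, hasc]
        -- Annihilation lowers the degree, so its bound is enlarged to the one already found for
        -- creation.
        have hm : (n + 1).ascFactorial k ≤ (n + 1 + 2).ascFactorial k :=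
          Nat.ascFactorial_le k (by omega)
        calc _ ≤ (2 * ‖u‖) ^ k * Real.sqrt ((n + 1).ascFactorial k) * ‖FinFock.single n y‖ :=
              ih n y
          _ ≤ (2 * ‖u‖) ^ k * Real.sqrt ((n + 1 + 2).ascFactorial k) *
              (Real.sqrt (((n + 1 : ℕ) : ℝ) + 1) * ‖u‖ * ‖FinFock.single (n + 1) x‖) := by
            have h3 : Real.sqrt ((n : ℝ) + 1) ≤ Real.sqrt (((n + 1 : ℕ) : ℝ) + 1) := by
              apply Real.sqrt_le_sqrt; push_cast; linarith
            have h4 : Real.sqrt ((n + 1).ascFactorial k) ≤ Real.sqrt ((n + 1 + 2).ascFactorial k) :=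
              Real.sqrt_le_sqrt (by exact_mod_cast hm)
            have h5 : ‖FinFock.single n y‖ ≤
                Real.sqrt (((n + 1 : ℕ) : ℝ) + 1) * ‖u‖ * ‖FinFock.single (n + 1) x‖ :=
              hb.trans (by gcongr)
            gcongr
          _ = _ := by ring
    rw [pow_succ, Module.End.mul_apply, displacement, LinearMap.sub_apply, ← displacement, map_sub]
    refine (norm_sub_le _ _).trans ((add_le_add h1 h2).trans (le_of_eq ?_))
    ring

theorem summable_pow_mul_sqrt_ascFactorial_div (C : ℝ) (hC : 0 ≤ C) (n : ℕ) :
    Summable fun k : ℕ => C ^ k * Real.sqrt ((n + 1).ascFactorial k) / k.factorial := by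
  refine summable_of_ratio_norm_eventually_le (r := 1 / 2) (by norm_num) ?_
  -- For such k, C²(n+1+k) ≤ C²(n+1)(k+1) ≤ k(k+1)/4 ≤ ((k+1)/2)², so consecutive terms have ratio
  -- at most 1/2.
  filter_upwards [Filter.eventually_ge_atTop ⌈4 * C ^ 2 * (n + 1)⌉₊] with k hk
  have hk' : 4 * C ^ 2 * (n + 1) ≤ k := (Nat.le_ceil _).trans (by exact_mod_cast hk)
  rw [Real.norm_of_nonneg (by positivity), Real.norm_of_nonneg (by positivity)]
  have h1 : C * Real.sqrt (n + 1 + k) ≤ 1 / 2 * (k + 1) := by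
    refine (pow_le_pow_iff_left₀ (by positivity) (by positivity) two_ne_zero).1 ?_
    rw [mul_pow, Real.sq_sqrt (by positivity)]
    have h2 : (n + 1 + k : ℝ) ≤ (n + 1) * (k + 1) := by
      have : (0 : ℝ) ≤ n * k := by positivity
      linarith
    nlinarith [mul_le_mul_of_nonneg_left h2 (sq_nonneg C), mul_le_mul_of_nonneg_right hk'
      (by positivity : (0 : ℝ) ≤ k + 1), Nat.cast_nonneg (α := ℝ) k]
  have h3 : Real.sqrt ((n + 1).ascFactorial (k + 1))
      = Real.sqrt (n + 1 + k) * Real.sqrt ((n + 1).ascFactorial k) := by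
    rw [← Real.sqrt_mul (by positivity), Nat.ascFactorial_succ]
    push_cast; rfl
  rw [h3, Nat.factorial_succ, pow_succ, div_le_iff₀ (by positivity)]
  have hf : (k.factorial : ℝ) ≠ 0 := by exact_mod_cast k.factorial_ne_zero
  calc C ^ k * C * (Real.sqrt (n + 1 + k) * Real.sqrt ((n + 1).ascFactorial k))
      = C ^ k * Real.sqrt ((n + 1).ascFactorial k) * (C * Real.sqrt (n + 1 + k)) := by ring
    _ ≤ C ^ k * Real.sqrt ((n + 1).ascFactorial k) * (1 / 2 * (k + 1)) := by gcongr
    _ = _ := by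
      push_cast
      field_simp

/-- The `k`-th term `(a†(u) - a(u))ᵏ Ψ / k!` of the exponential series. -/
def weylTerm (u : h) (k : ℕ) : FinFock h →ₗ[ℂ] FinFock h :=
  ((k.factorial : ℂ)⁻¹) • displacement u ^ k

/-- Finite particle vectors are analytic vectors of the displacement generator. -/
theorem summable_norm_weylTerm (u : h) (Ψ : FinFock h) :
    Summable fun k => ‖weylTerm u k Ψ‖ := by
  induction Ψ using FinFock.induction with
  | h0 => simp
  | ha Ψ Φ h1 h2 =>
    refine Summable.of_nonneg_of_le (fun _ => norm_nonneg _) (fun k => ?_) (h1.add h2)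
    rw [map_add]
    exact norm_add_le _ _
  | hs n x =>
    refine Summable.of_nonneg_of_le (fun _ => norm_nonneg _) (fun k => ?_)
      ((summable_pow_mul_sqrt_ascFactorial_div (2 * ‖u‖) (by positivity) n).mul_right
        ‖FinFock.single n x‖)
    rw [weylTerm, LinearMap.smul_apply, norm_smul, norm_inv, Complex.norm_natCast, div_eq_inv_mul,
      mul_assoc]
    exact mul_le_mul_of_nonneg_left (norm_displacement_pow_single_le u k n x) (by positivity)

/-- The inclusion of the finite particle vectors into the Fock space. -/
def toFock : FinFock h →ₗ[ℂ] FockSpace h :=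
  (Completion.toComplₗᵢ (𝕜 := ℂ) (E := FinFock h)).toLinearMap

theorem norm_toFock (Ψ : FinFock h) : ‖toFock Ψ‖ = ‖Ψ‖ := Completion.norm_coe Ψ

theorem inner_toFock (Ψ Φ : FinFock h) : inner ℂ (toFock Ψ) (toFock Φ) = inner ℂ Ψ Φ :=
  Completion.inner_coe Ψ Φ

theorem denseRange_toFock : DenseRange (toFock (h := h)) := Completion.denseRange_coe

theorem summable_toFock_weylTerm (u : h) (Ψ : FinFock h) :
    Summable fun k => toFock (weylTerm u k Ψ) :=
  Summable.of_norm (by simpa only [norm_toFock] using summable_norm_weylTerm u Ψ)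

/-- The Weyl operator `e^{a†(u) - a(u)}` on finite particle vectors. -/
def weylFin (u : h) : FinFock h →ₗ[ℂ] FockSpace h where
  toFun Ψ := ∑' k, toFock (weylTerm u k Ψ)
  map_add' Ψ Φ := by
    simp only [map_add]
    exact (summable_toFock_weylTerm u Ψ).tsum_add (summable_toFock_weylTerm u Φ)
  map_smul' c Ψ := by
    simp only [map_smul, RingHom.id_apply]
    exact (summable_toFock_weylTerm u Ψ).tsum_const_smul c

theorem hasSum_weylFin (u : h) (Ψ : FinFock h) :
    HasSum (fun k => toFock (weylTerm u k Ψ)) (weylFin u Ψ) :=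
  (summable_toFock_weylTerm u Ψ).hasSum

/-- Skew-symmetry moves all powers to the right at the cost of signs, leaving (1/m!) ⟨Ψ, Dᵐ Φ⟩ times
the binomial expansion of (-1 + 1)ᵐ, where D is the generator. -/
theorem sum_antidiagonal_inner_weylTerm (u : h) (Ψ Φ : FinFock h) (m : ℕ) :
    ∑ p ∈ Finset.HasAntidiagonal.antidiagonal m, inner ℂ (weylTerm u p.1 Ψ) (weylTerm u p.2 Φ)
      = if m = 0 then inner ℂ Ψ Φ else 0 := by
  have hterm : ∀ p ∈ Finset.HasAntidiagonal.antidiagonal m,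
      inner ℂ (weylTerm u p.1 Ψ) (weylTerm u p.2 Φ)
        = ((m.factorial : ℂ)⁻¹ * inner ℂ Ψ ((displacement u ^ m) Φ)) *
          (m.choose p.1 • ((-1) ^ p.1 * 1 ^ p.2)) := by
    intro p hp
    rw [Finset.HasAntidiagonal.mem_antidiagonal] at hp
    subst hp
    rw [weylTerm, weylTerm, LinearMap.smul_apply, LinearMap.smul_apply, inner_smul_left,
      inner_smul_right, inner_displacement_pow, ← Module.End.mul_apply, ← pow_add, map_inv₀,
      Complex.conj_natCast, nsmul_eq_mul, Nat.choose_symm_add, Nat.add_choose]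
    have f1 : (p.1.factorial : ℂ) ≠ 0 := by exact_mod_cast p.1.factorial_ne_zero
    have f2 : (p.2.factorial : ℂ) ≠ 0 := by exact_mod_cast p.2.factorial_ne_zero
    have f3 : ((p.1 + p.2).factorial : ℂ) ≠ 0 := by exact_mod_cast (p.1 + p.2).factorial_ne_zero
    rw [Nat.cast_div (Nat.factorial_mul_factorial_dvd_factorial_add _ _)
      (by rw [Nat.cast_mul]; exact mul_ne_zero f1 f2)]
    push_cast
    field_simp
    ring
  rw [Finset.sum_congr rfl hterm, ← Finset.mul_sum,
    ← (Commute.all (-1 : ℂ) 1).add_pow', neg_add_cancel]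
  split_ifs with hm
  · subst hm; simp
  · rw [zero_pow hm, mul_zero]

/-- The inner product of two absolutely convergent series is a double series; summed along
antidiagonals, only total degree 0 survives. -/
theorem inner_weylFin (u : h) (Ψ Φ : FinFock h) :
    inner ℂ (weylFin u Ψ) (weylFin u Φ) = inner ℂ Ψ Φ := by
  have hs : Summable fun p : ℕ × ℕ => inner ℂ (toFock (weylTerm u p.1 Ψ)) (toFock (weylTerm u p.2 Φ)) := by
    refine Summable.of_norm_bounded
      (Summable.mul_of_nonneg (summable_norm_weylTerm u Ψ) (summable_norm_weylTerm u Φ)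
        (fun _ => norm_nonneg _) fun _ => norm_nonneg _) fun p => ?_
    rw [inner_toFock]
    exact norm_inner_le_norm _ _
  have h1 : HasSum (fun p : ℕ × ℕ =>
      inner ℂ (toFock (weylTerm u p.1 Ψ)) (toFock (weylTerm u p.2 Φ)))
      (inner ℂ (weylFin u Ψ) (weylFin u Φ)) := by
    have h2 : ∀ k, HasSum (fun j => inner ℂ (toFock (weylTerm u k Ψ)) (toFock (weylTerm u j Φ)))
        (inner ℂ (toFock (weylTerm u k Ψ)) (weylFin u Φ)) := fun k =>
      (hasSum_weylFin u Φ).mapL (innerSL ℂ (toFock (weylTerm u k Ψ)))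
    have h3 : HasSum (fun k => inner ℂ (toFock (weylTerm u k Ψ)) (weylFin u Φ))
        (inner ℂ (weylFin u Ψ) (weylFin u Φ)) :=
      (hasSum_weylFin u Ψ).mapL ((innerSL ℂ).flip (weylFin u Φ))
    rw [← (hs.hasSum.prod_fiberwise h2).unique h3]
    exact hs.hasSum
  have h4 := (Finset.HasAntidiagonal.sigmaAntidiagonalEquivProd (A := ℕ)).hasSum_iff.2 h1
  have h5 := h4.sigma fun m => hasSum_fintype _
  have h6 : HasSum (fun m : ℕ => if m = 0 then inner ℂ Ψ Φ else 0)
      (inner ℂ (weylFin u Ψ) (weylFin u Φ)) := by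
    convert h5 using 2 with m
    rw [← sum_antidiagonal_inner_weylTerm u, ← Finset.sum_coe_sort]
    exact Finset.sum_congr rfl fun p _ => (inner_toFock _ _).symm
  exact h6.unique (hasSum_ite_eq 0 _)

theorem norm_weylFin (u : h) (Ψ : FinFock h) : ‖weylFin u Ψ‖ = ‖toFock Ψ‖ := by
  rw [norm_toFock, ← sq_eq_sq₀ (norm_nonneg _) (norm_nonneg _),
    InnerProductSpace.norm_sq_eq_re_inner (𝕜 := ℂ), inner_weylFin,
    InnerProductSpace.norm_sq_eq_re_inner (𝕜 := ℂ)]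

/-- Skew-symmetry, term by term. It makes the Weyl operator of -u the adjoint of that of u, so
invertibility follows from isometry without multiplying exponential series. -/
theorem inner_weylFin_neg (u : h) (Ψ Φ : FinFock h) :
    inner ℂ (weylFin (-u) Ψ) (toFock Φ) = inner ℂ (toFock Ψ) (weylFin u Φ) := by
  have h1 := (hasSum_weylFin u Φ).mapL (innerSL ℂ (toFock Ψ))
  have h2 := (hasSum_weylFin (-u) Ψ).mapL ((innerSL ℂ).flip (toFock Φ))
  refine h2.unique ?_
  refine h1.congr_fun fun k => ?_
  change inner ℂ (toFock (weylTerm (-u) k Ψ)) (toFock Φ)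
    = inner ℂ (toFock Ψ) (toFock (weylTerm u k Φ))
  rw [inner_toFock, inner_toFock, weylTerm, weylTerm, LinearMap.smul_apply, LinearMap.smul_apply,
    inner_smul_left, inner_smul_right, inner_displacement_pow, displacement_neg, map_inv₀,
    Complex.conj_natCast]
  rcases k.even_or_odd with hk | hk
  · rw [hk.neg_pow, hk.neg_pow, one_pow, one_mul]
  · rw [hk.neg_pow, hk.neg_pow, one_pow, LinearMap.neg_apply, inner_neg_right, neg_mul_neg, one_mul]

/-- The Weyl operator `e^{a†(u) - a(u)}` on the Fock space. -/
def weyl (u : h) : FockSpace h →L[ℂ] FockSpace h := (weylFin u).extendOfNorm toFock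

theorem weyl_toFock (u : h) (Ψ : FinFock h) : weyl u (toFock Ψ) = weylFin u Ψ :=
  LinearMap.extendOfNorm_eq denseRange_toFock
    ⟨1, fun Ψ => by rw [one_mul, norm_weylFin]⟩ Ψ

theorem norm_weyl (u : h) (x : FockSpace h) : ‖weyl u x‖ = ‖x‖ := by
  refine denseRange_toFock.induction_on x (isClosed_eq (by fun_prop) (by fun_prop)) fun Ψ => ?_
  rw [weyl_toFock, norm_weylFin]

theorem inner_weyl_neg (u : h) (x y : FockSpace h) :
    inner ℂ (weyl (-u) x) y = inner ℂ x (weyl u y) := by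
  refine denseRange_toFock.induction_on₂
    (isClosed_eq (by fun_prop) (by fun_prop)) (fun Ψ Φ => ?_) x y
  rw [weyl_toFock, weyl_toFock, inner_weylFin_neg]

theorem weyl_neg_weyl (u : h) (x : FockSpace h) : weyl (-u) (weyl u x) = x := by
  let W : FockSpace h →ₗᵢ[ℂ] FockSpace h := ⟨(weyl u).toLinearMap, norm_weyl u⟩
  refine ext_inner_right ℂ fun y => ?_
  rw [inner_weyl_neg]
  exact W.inner_map_map x y

/-- The Weyl operator as a unitary operator. -/
def weylUnitary (u : h) : FockSpace h ≃ₗᵢ[ℂ] FockSpace h where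
  toFun := weyl u
  map_add' := map_add _
  map_smul' := map_smul _
  invFun := weyl (-u)
  left_inv := weyl_neg_weyl u
  right_inv x := by simpa using weyl_neg_weyl (-u) x
  norm_map' := norm_weyl u

end Displacement

/-! ### Weyl operators shift the fields by numbers. -/

section FieldShift

/-- Only [a(f), a†(u)] = ⟨f, u⟩ and [a†(f), a(u)] = -⟨u, f⟩ contribute, and ⟨f, u⟩ + ⟨u, f⟩ = 2
Re⟨u, f⟩. -/
theorem finField_mul_displacement (f u : h) :
    finField f * displacement u
      = displacement u * finField f + ((Real.sqrt 2 * (inner ℂ u f).re : ℝ) : ℂ) • 1 := by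
  have h1 : ann f * create u = create u * ann f + inner ℂ f u • 1 := annihilate_mul_create _ u
  have h2 : ann u * create f = create f * ann u + inner ℂ u f • 1 := annihilate_mul_create _ f
  have h3 : create f * create u = create u * create f := create_commute f u
  have h4 : ann f * ann u = ann u * ann f := annihilate_commute _ _
  have hs : (Real.sqrt 2 : ℂ) ≠ 0 := by simp
  have h5 : ((Real.sqrt 2 * (inner ℂ u f).re : ℝ) : ℂ)
      = (Real.sqrt 2 : ℂ)⁻¹ * (inner ℂ f u + inner ℂ u f) := by
    have h6 : inner ℂ f u + inner ℂ u f = (2 : ℂ) * ((inner ℂ u f).re : ℂ) := by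
      rw [← inner_conj_symm f u, add_comm, Complex.add_conj]
      push_cast; rfl
    have h7 : (Real.sqrt 2 : ℂ) * (Real.sqrt 2 : ℂ) = 2 := by
      rw [← Complex.ofReal_mul, Real.mul_self_sqrt (by norm_num)]; simp
    rw [h6, ← h7]
    push_cast
    field_simp
  rw [h5, finField, displacement, smul_mul_assoc, mul_smul_comm, mul_smul, ← smul_add]
  congr 1
  simp only [add_mul, mul_add, mul_sub, sub_mul, h1, h2, h3, h4, add_smul]
  abel

/-- A scalar commutator makes [B, ·] act on powers of A as c times differentiation. -/
theorem mul_pow_succ_of_mul_eq {A B : FinFock h →ₗ[ℂ] FinFock h} {c : ℂ}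
    (hc : B * A = A * B + c • 1) (k : ℕ) :
    B * A ^ (k + 1) = A ^ (k + 1) * B + (((k + 1 : ℕ) : ℂ) * c) • A ^ k := by
  induction k with
  | zero => simpa using hc
  | succ k ih =>
    rw [pow_succ A (k + 1), ← mul_assoc, ih, add_mul, mul_assoc, hc, smul_mul_assoc, ← pow_succ,
      mul_add, mul_smul_comm, mul_one, ← mul_assoc, add_assoc, ← add_smul]
    push_cast
    ring_nf

/-- Differentiating Aᵏ/k! lowers the index by one, so the shift term carries one summand fewer; both
partial sums still tend to the same limit. -/
theorem finField_sum_weylTerm (f u : h) (Ψ : FinFock h) (N : ℕ) :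
    finField f (∑ k ∈ Finset.range (N + 1), weylTerm u k Ψ)
      = ∑ k ∈ Finset.range (N + 1), weylTerm u k (finField f Ψ)
        + ((Real.sqrt 2 * (inner ℂ u f).re : ℝ) : ℂ) • ∑ k ∈ Finset.range N, weylTerm u k Ψ := by
  rw [Finset.sum_range_succ', Finset.sum_range_succ' (fun k => weylTerm u k (finField f Ψ)),
    map_add, map_sum, Finset.smul_sum, add_right_comm, ← Finset.sum_add_distrib]
  congr 1
  · refine Finset.sum_congr rfl fun k _ => ?_
    have := LinearMap.congr_fun (mul_pow_succ_of_mul_eq (finField_mul_displacement f u) k) Ψ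
    simp only [Module.End.mul_apply, LinearMap.add_apply, LinearMap.smul_apply] at this
    simp only [weylTerm, LinearMap.smul_apply, map_smul, this, smul_add, smul_smul,
      Nat.factorial_succ]
    have f1 : (k.factorial : ℂ) ≠ 0 := by exact_mod_cast k.factorial_ne_zero
    have f2 : ((k + 1 : ℕ) : ℂ) ≠ 0 := by exact_mod_cast k.succ_ne_zero
    congr 2
    rw [Nat.cast_mul]
    field_simp
  · simp [weylTerm]

theorem fockField_graph (f : h) :
    (fockField f).graph = (finGraph (finField f)).topologicalClosure :=
  finClosure_graph _ (finField_symm f)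

/-- The partial sums of the Weyl series are finite particle vectors, hence in the domain, and their
images converge; the graph is closed. -/
theorem weyl_mem_fockField_graph (f u : h) {x y : FockSpace h} (hxy : (x, y) ∈ (fockField f).graph) :
    (weyl u x, weyl u y + ((Real.sqrt 2 * (inner ℂ u f).re : ℝ) : ℂ) • weyl u x)
      ∈ (fockField f).graph := by
  set c : ℂ := ((Real.sqrt 2 * (inner ℂ u f).re : ℝ) : ℂ)
  rw [fockField_graph] at hxy ⊢
  have hclosed := (finGraph (finField f)).isClosed_topologicalClosure
  have hcont : Continuous fun p : FockSpace h × FockSpace h =>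
      (weyl u p.1, weyl u p.2 + c • weyl u p.1) :=
    ((weyl u).continuous.comp continuous_fst).prodMk
      (((weyl u).continuous.comp continuous_snd).add
        (((weyl u).continuous.comp continuous_fst).const_smul c))
  rw [← SetLike.mem_coe, ← hclosed.closure_eq]
  refine map_mem_closure (f := fun p : FockSpace h × FockSpace h =>
    (weyl u p.1, weyl u p.2 + c • weyl u p.1)) (x := (x, y)) hcont hxy ?_
  rintro _ ⟨Ψ, rfl⟩
  change (weyl u (toFock Ψ), weyl u (toFock (finField f Ψ)) + c • weyl u (toFock Ψ)) ∈ _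
  rw [weyl_toFock, weyl_toFock]
  have h1 := (hasSum_weylFin u Ψ).tendsto_sum_nat
  have h2 := (hasSum_weylFin u (finField f Ψ)).tendsto_sum_nat
  have h3 := ((Filter.tendsto_add_atTop_iff_nat 1).2 h1).prodMk_nhds
    (((Filter.tendsto_add_atTop_iff_nat 1).2 h2).add (h1.const_smul c))
  refine hclosed.mem_of_tendsto h3 (Filter.Eventually.of_forall fun N => ?_)
  refine Submodule.le_topologicalClosure _ ⟨∑ k ∈ Finset.range (N + 1), weylTerm u k Ψ, ?_⟩
  change (toFock _, toFock (finField f _)) = _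
  rw [finField_sum_weylTerm, map_add, map_smul, map_sum, map_sum, map_sum]

/-- The inverse Weyl operator shifts by the opposite number, so the inclusion is an equality of
domains. -/
theorem weyl_mem_fockField_graph_iff (f u : h) {x y : FockSpace h} :
    (weyl u x, weyl u y + ((Real.sqrt 2 * (inner ℂ u f).re : ℝ) : ℂ) • weyl u x)
      ∈ (fockField f).graph ↔ (x, y) ∈ (fockField f).graph := by
  refine ⟨fun hxy => ?_, weyl_mem_fockField_graph f u⟩
  have := weyl_mem_fockField_graph f (-u) hxy
  simp only [map_add, map_smul, weyl_neg_weyl, inner_neg_left, Complex.neg_re, mul_neg,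
    Complex.ofReal_neg, neg_smul, add_neg_cancel_right] at this
  exact this

end FieldShift

end Weyl

/-! ### Unbounded operators through their graphs, which encode domains too. -/

section Graphs

variable {H K : Type*} [NormedAddCommGroup H] [InnerProductSpace ℂ H]
  [NormedAddCommGroup K] [InnerProductSpace ℂ K]

theorem mem_addScalar_graph {A : H →ₗ.[ℂ] H} {c : ℂ} {x y : H} :
    (x, y) ∈ (addScalar A c).graph ↔ (x, y - c • x) ∈ A.graph := by
  rw [LinearPMap.mem_graph_iff, LinearPMap.mem_graph_iff]
  constructor
  · rintro ⟨z, rfl, hz⟩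
    refine ⟨z, rfl, ?_⟩
    change A z + c • (z : H) = y at hz
    exact eq_sub_of_add_eq hz
  · rintro ⟨z, rfl, hz⟩
    refine ⟨z, rfl, ?_⟩
    change A z + c • (z : H) = y
    exact add_eq_of_eq_sub hz

theorem mem_sandwich_graph {V : K ≃ₗᵢ[ℂ] H} {A : K →ₗ.[ℂ] K} {U : H ≃ₗᵢ[ℂ] K} {x y : H} :
    (x, y) ∈ (sandwich V A U).graph ↔ (U x, V.symm y) ∈ A.graph := by
  rw [LinearPMap.mem_graph_iff, LinearPMap.mem_graph_iff]
  constructor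
  · rintro ⟨z, rfl, rfl⟩
    exact ⟨⟨U z, z.2⟩, rfl, (V.symm_apply_apply _).symm⟩
  · rintro ⟨⟨z, hz⟩, hzx, hzy⟩
    obtain rfl : z = U x := hzx
    refine ⟨⟨x, hz⟩, rfl, ?_⟩
    change V (A ⟨U x, hz⟩) = y
    rw [hzy, V.apply_symm_apply]

theorem Intertwines.map_mem_graph {S : H →L[ℂ] K} {A : H →ₗ.[ℂ] H} {B : K →ₗ.[ℂ] K}
    (hS : Intertwines S A B) {x y : H} (hxy : (x, y) ∈ A.graph) : (S x, S y) ∈ B.graph := by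
  obtain ⟨z, rfl, rfl⟩ := (LinearPMap.mem_graph_iff _).1 hxy
  obtain ⟨hz, he⟩ := hS z
  exact (LinearPMap.mem_graph_iff _).2 ⟨⟨S z, hz⟩, rfl, he⟩

end Graphs

/-! ### Intertwiners force the shift to be bounded. -/

section Disjointness

variable {h : Type*} [NormedAddCommGroup h] [InnerProductSpace ℂ h]

theorem toFock_mem_fockField_graph (f : h) (Ψ : FinFock h) :
    (toFock Ψ, toFock (finField f Ψ)) ∈ (fockField f).graph := by
  rw [fockField_graph]
  exact Submodule.le_topologicalClosure _ ⟨Ψ, rfl⟩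

/-- Moves the field off a general domain vector, such as S Ψ, onto a finite particle vector, where
it is explicit and bounded in f. -/
theorem inner_eq_of_mem_fockField_graph {f : h} {x y : FockSpace h}
    (hxy : (x, y) ∈ (fockField f).graph) (Φ : FinFock h) :
    inner ℂ (toFock Φ) y = inner ℂ (toFock (finField f Φ)) x := by
  rw [fockField_graph] at hxy
  refine closure_minimal (t := {q : FockSpace h × FockSpace h |
    inner ℂ (toFock Φ) q.2 = inner ℂ (toFock (finField f Φ)) q.1}) ?_
    (isClosed_eq (by fun_prop) (by fun_prop)) hxy
  rintro _ ⟨Ψ, rfl⟩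
  change inner ℂ (toFock Φ) (toFock (finField f Ψ)) = inner ℂ (toFock (finField f Φ)) (toFock Ψ)
  rw [inner_toFock, inner_toFock]
  exact (finField_symm f Φ Ψ).symm

-- The vacuum, the empty tensor product, has norm 1.
instance : Nontrivial (FockSpace h) := by
  refine nontrivial_of_ne
    (toFock (FinFock.single 0 (symmetrizer 0 (PiTensorProduct.tprod ℂ Fin.elim0)))) 0 ?_
  have e : (symmetrizer 0 (PiTensorProduct.tprod ℂ Fin.elim0 : ⨂[ℂ]^0 h) : ⨂[ℂ]^0 h)
      = PiTensorProduct.tprod ℂ Fin.elim0 := by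
    rw [coe_symmetrizer]
    simp only [permute_tprod, Nat.factorial_zero, Nat.cast_one, inv_one, one_smul,
      Finset.univ_unique, Finset.sum_singleton]
    exact congrArg _ (Subsingleton.elim _ _)
  rw [← norm_ne_zero_iff, norm_toFock, ← pow_ne_zero_iff two_ne_zero, FinFock.norm_single_sq, e,
    tensorInner_tprod]
  simp

/-- A nonzero bounded operator can intertwine the fields with shifted fields only if the shift is
bounded by the norm of the test vector. -/
theorem exists_shift_le {S : FockSpace h →L[ℂ] FockSpace h} (hS : S ≠ 0) :
    ∃ C : ℝ, ∀ (f : h) (c : ℝ),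
      (∀ x y, (x, y) ∈ (fockField f).graph → (S x, S y + (c : ℂ) • S x) ∈ (fockField f).graph) →
      |c| ≤ C * ‖f‖ := by
  -- By density, an operator all of whose matrix elements between finite particle vectors vanish is
  -- zero.
  obtain ⟨Φ, Ψ, hne⟩ : ∃ Φ Ψ : FinFock h, inner ℂ (toFock Φ) (S (toFock Ψ)) ≠ 0 := by
    by_contra! hcon
    refine hS (ContinuousLinearMap.ext fun x => ext_inner_left ℂ fun y => ?_)
    rw [zero_apply, inner_zero_right]
    exact denseRange_toFock.induction_on₂ (p := fun y x => inner ℂ y (S x) = 0)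
      (isClosed_eq (by fun_prop) (by fun_prop)) hcon y x
  obtain ⟨C, hC⟩ := exists_norm_finField_le Φ
  obtain ⟨D, hD⟩ := exists_norm_finField_le Ψ
  set m := ‖inner ℂ (toFock Φ) (S (toFock Ψ))‖ with hm
  have hm0 : 0 < m := norm_pos_iff.2 hne
  refine ⟨(C * ‖S (toFock Ψ)‖ + ‖toFock Φ‖ * (‖S‖ * D)) / m, fun f c hf => ?_⟩
  have h1 := inner_eq_of_mem_fockField_graph (hf _ _ (toFock_mem_fockField_graph f Ψ)) Φ
  rw [inner_add_right, inner_smul_right] at h1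
  -- The shift times a fixed nonzero number, written with fields acting only on Φ and Ψ.
  have h2 : (c : ℂ) * inner ℂ (toFock Φ) (S (toFock Ψ))
      = inner ℂ (toFock (finField f Φ)) (S (toFock Ψ))
        - inner ℂ (toFock Φ) (S (toFock (finField f Ψ))) := by
    rw [← h1]; ring
  have h3 : |c| * m ≤ C * ‖f‖ * ‖S (toFock Ψ)‖ + ‖toFock Φ‖ * (‖S‖ * (D * ‖f‖)) := by
    rw [← Real.norm_eq_abs, ← Complex.norm_real, hm, ← norm_mul, h2]
    refine (norm_sub_le _ _).trans (add_le_add ?_ ?_)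
    · refine (norm_inner_le_norm _ _).trans ?_
      rw [norm_toFock]
      exact mul_le_mul_of_nonneg_right (hC f) (norm_nonneg _)
    · refine (norm_inner_le_norm _ _).trans (mul_le_mul_of_nonneg_left ?_ (norm_nonneg _))
      refine (S.le_opNorm _).trans (mul_le_mul_of_nonneg_left ?_ (norm_nonneg _))
      rw [norm_toFock]
      exact hD f
  rw [div_mul_eq_mul_div, le_div_iff₀ hm0]
  linarith

end Disjointness

/-! ### Transport between F_g and F(h), and the three claims. -/

namespace GelfandTriple

variable {T h : Type*} [AddCommGroup T] [Module ℂ T] [TopologicalSpace T]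
  [NormedAddCommGroup h] [InnerProductSpace ℂ h] (G : GelfandTriple T h)

/-- The bound extends the bracket continuously from the dense image of T to h, and Riesz represents
it; completeness of h enters here. -/
theorem mem_range_toAntidual_of_bound [CompleteSpace h] {g : T →L⋆[ℂ] ℂ} {C : ℝ}
    (hC : ∀ f, ‖bracket g f‖ ≤ C * ‖G.emb f‖) : g ∈ Set.range G.toAntidual := by
  let L : h →L[ℂ] ℂ := (bracket g).extendOfNorm G.emb.toLinearMap
  refine ⟨(InnerProductSpace.toDual ℂ h).symm L, ContinuousLinearMap.ext fun f => ?_⟩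
  have h1 : bracket (G.toAntidual ((InnerProductSpace.toDual ℂ h).symm L)) f = bracket g f := by
    rw [bracket_toAntidual, InnerProductSpace.toDual_symm_apply]
    exact LinearMap.extendOfNorm_eq G.dense ⟨C, hC⟩ f
  exact (starRingEnd ℂ).injective h1

theorem bracket_sub (g g' : T →L⋆[ℂ] ℂ) (f : T) :
    bracket (g - g') f = bracket g f - bracket g' f := by
  simp [bracket]

theorem neg_I_smul_re (g : T →L⋆[ℂ] ℂ) (f : T) :
    (bracket g (-Complex.I • f)).re = (bracket g f).im := by
  rw [map_smul]
  simp

/-- The shift functional of an intertwiner of shifted Fock fields is an element of `h`. -/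
theorem mem_range_toAntidual_of_intertwines [CompleteSpace h] {g : T →L⋆[ℂ] ℂ}
    {S : FockSpace h →L[ℂ] FockSpace h} (hS : S ≠ 0)
    (hφ : ∀ f x y, (x, y) ∈ (fockField (G.emb f)).graph →
      (S x, S y + ((Real.sqrt 2 * (bracket g f).re : ℝ) : ℂ) • S x) ∈ (fockField (G.emb f)).graph) :
    g ∈ Set.range G.toAntidual := by
  obtain ⟨C, hC⟩ := exists_shift_le hS
  have hre : ∀ f, |(bracket g f).re| ≤ C * ‖G.emb f‖ := fun f => by
    refine le_trans ?_ (hC _ _ (hφ f))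
    rw [abs_mul, abs_of_nonneg (Real.sqrt_nonneg 2)]
    exact le_mul_of_one_le_left (abs_nonneg _) (Real.one_le_sqrt.2 (by norm_num))
  refine G.mem_range_toAntidual_of_bound (C := C + C) fun f => ?_
  refine (Complex.norm_le_abs_re_add_abs_im _).trans ?_
  rw [add_mul]
  refine add_le_add (hre f) ?_
  -- The test function -i f has the same norm and turns the real part into the imaginary part, so
  -- fields alone control the whole bracket.
  have := hre (-Complex.I • f)
  rwa [neg_I_smul_re, map_smul, norm_smul, norm_neg, Complex.norm_I, one_mul] at this

theorem fields_π (g : T →L⋆[ℂ] ℂ) (f : T) :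
    (G.fields g).π f = (G.fields g).φ (-Complex.I • f) := by
  simp only [fields, fockMomentum_eq_fockField, neg_I_smul_re, map_smul G.emb]

theorem mem_fields_graph {g : T →L⋆[ℂ] ℂ} {f : T} {x y : G.RenFock g} :
    (x, y) ∈ ((G.fields g).φ f).graph ↔
      (G.dressingToFock g x, G.dressingToFock g y -
        ((Real.sqrt 2 * (bracket g f).re : ℝ) : ℂ) • G.dressingToFock g x)
        ∈ (fockField (G.emb f)).graph := by
  rw [fields, mem_sandwich_graph, mem_addScalar_graph, LinearIsometryEquiv.symm_symm]

theorem dressing_toRenFock (g g' : T →L⋆[ℂ] ℂ) (Ψ : FinFock T) :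
    G.dressing g g' (G.toRenFock g Ψ) = G.toRenFock g' (expAnnihilate (bracket (g - g')) Ψ) :=
  LinearEquiv.extendOfIsometry_eq ..

theorem dressingToFock_toRenFock (g : T →L⋆[ℂ] ℂ) (Ψ : FinFock T) :
    G.dressingToFock g (G.toRenFock g Ψ) = toFock (G.dress g Ψ) :=
  LinearEquiv.extendOfIsometry_eq ..

/-- On the dense image of finite particle vectors this is e^{a(g')} e^{a(g-g')} = e^{a(g)}. -/
theorem dressingToFock_dressing (g g' : T →L⋆[ℂ] ℂ) (x : G.RenFock g) :
    G.dressingToFock g' (G.dressing g g' x) = G.dressingToFock g x := by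
  refine (G.denseRange_toRenFock g).induction_on x
    (isClosed_eq (by fun_prop) (by fun_prop)) fun Ψ => ?_
  rw [dressing_toRenFock, dressingToFock_toRenFock, dressingToFock_toRenFock]
  have hb : bracket g' + bracket (g - g') = bracket g := by
    ext f; simp [bracket]
  have := LinearMap.congr_fun (expAnnihilate_comp (bracket g') (bracket (g - g'))) Ψ
  rw [hb] at this
  rw [dress, dress, LinearMap.comp_apply, LinearMap.comp_apply, ← this, LinearMap.comp_apply]

theorem dressing_symm (g g' : T →L⋆[ℂ] ℂ) : (G.dressing g' g).symm = G.dressing g g' := by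
  ext x
  rw [LinearIsometryEquiv.symm_apply_eq]
  refine (G.dressingToFock g).injective ?_
  rw [dressingToFock_dressing, dressingToFock_dressing]

theorem fields_φ_eq_sandwich (g g' : T →L⋆[ℂ] ℂ) (f : T) :
    (G.fields g).φ f = sandwich (G.dressing g' g)
      (addScalar ((G.fields g').φ f) (Real.sqrt 2 * (bracket (g - g') f).re : ℝ))
      (G.dressing g g') := by
  refine LinearPMap.eq_of_eq_graph (SetLike.ext ?_)
  rintro ⟨x, y⟩
  rw [mem_sandwich_graph, mem_addScalar_graph, mem_fields_graph, mem_fields_graph, dressing_symm,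
    map_sub, map_smul, dressingToFock_dressing, dressingToFock_dressing, sub_sub, ← add_smul,
    bracket_sub]
  have : ((Real.sqrt 2 * (bracket g f - bracket g' f).re : ℝ) : ℂ)
      + ((Real.sqrt 2 * (bracket g' f).re : ℝ) : ℂ) = ((Real.sqrt 2 * (bracket g f).re : ℝ) : ℂ) := by
    rw [← Complex.ofReal_add, Complex.sub_re]; ring_nf
  rw [this]

theorem fields_π_eq_sandwich (g g' : T →L⋆[ℂ] ℂ) (f : T) :
    (G.fields g).π f = sandwich (G.dressing g' g)
      (addScalar ((G.fields g').π f) (Real.sqrt 2 * (bracket (g - g') f).im : ℝ))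
      (G.dressing g g') := by
  rw [fields_π, fields_π, ← neg_I_smul_re, fields_φ_eq_sandwich G g g']

theorem mem_range_of_unitarilyEquivalent [CompleteSpace h] {g g' : T →L⋆[ℂ] ℂ}
    (hV : UnitarilyEquivalent (G.fields g) (G.fields g')) : g - g' ∈ Set.range G.toAntidual := by
  obtain ⟨V, hV⟩ := hV
  let W : FockSpace h ≃ₗᵢ[ℂ] FockSpace h :=
    ((G.dressingToFock g).symm.trans V).trans (G.dressingToFock g')
  have hW : (W : FockSpace h →L[ℂ] FockSpace h) ≠ 0 := by
    obtain ⟨Ω, hΩ⟩ := exists_ne (0 : FockSpace h)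
    intro h0
    exact hΩ (W.map_eq_zero_iff.1 (congrArg (fun S : FockSpace h →L[ℂ] FockSpace h => S Ω) h0))
  -- On F(h), W carries the fields shifted by g to those shifted by g', so it intertwines with
  -- relative shift g - g'.
  refine G.mem_range_toAntidual_of_intertwines hW fun f x y hxy => ?_
  have h1 : ((G.dressingToFock g).symm x, (G.dressingToFock g).symm y +
      ((Real.sqrt 2 * (bracket g f).re : ℝ) : ℂ) • (G.dressingToFock g).symm x)
        ∈ ((G.fields g).φ f).graph := by
    rw [mem_fields_graph, map_add, map_smul, LinearIsometryEquiv.apply_symm_apply,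
      LinearIsometryEquiv.apply_symm_apply, add_sub_cancel_right]
    exact hxy
  rw [(hV f).1, mem_sandwich_graph, mem_fields_graph, LinearIsometryEquiv.symm_symm, map_add,
    map_smul, map_add, map_smul, add_sub_assoc, ← sub_smul] at h1
  rw [← Complex.ofReal_sub, ← mul_sub, ← Complex.sub_re, ← bracket_sub] at h1
  exact h1

theorem unitarilyEquivalent_of_mem_range {g g' : T →L⋆[ℂ] ℂ}
    (hg : g - g' ∈ Set.range G.toAntidual) : UnitarilyEquivalent (G.fields g) (G.fields g') := by
  obtain ⟨u, hu⟩ := hg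
  -- Conjugation by the Weyl operator of u = g - g' adds √2 Re⟨u, f⟩ to the free field, turning the
  -- shift by g' into the shift by g.
  let V : G.RenFock g ≃ₗᵢ[ℂ] G.RenFock g' :=
    ((G.dressingToFock g).trans (weylUnitary u)).trans (G.dressingToFock g').symm
  have hV : ∀ x, G.dressingToFock g' (V x) = weyl u (G.dressingToFock g x) := fun x =>
    (G.dressingToFock g').apply_symm_apply _
  have hφ : ∀ f, (G.fields g).φ f = sandwich V.symm ((G.fields g').φ f) V := by
    intro f
    refine LinearPMap.eq_of_eq_graph (SetLike.ext ?_)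
    rintro ⟨x, y⟩
    rw [mem_sandwich_graph, mem_fields_graph, mem_fields_graph, LinearIsometryEquiv.symm_symm,
      hV, hV, ← weyl_mem_fockField_graph_iff _ u, map_sub, map_smul, sub_add, ← sub_smul,
      ← bracket_toAntidual, hu, bracket_sub, ← Complex.ofReal_sub, Complex.sub_re]
    ring_nf
  exact ⟨V, fun f => ⟨hφ f, by rw [fields_π, fields_π]; exact hφ _⟩⟩

theorem disjointRep_of_notMem_range [CompleteSpace h] {g : T →L⋆[ℂ] ℂ}
    (hg : g ∉ Set.range G.toAntidual) : DisjointRep (G.fields g) G.fockFields := by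
  intro S hS
  by_contra hne
  refine hg ?_
  -- Precomposing with the inverse dressing unitary gives an operator on F(h) that still does not
  -- vanish; it need only be bounded.
  have hne' : S ∘L ((G.dressingToFock g).symm : FockSpace h →L[ℂ] G.RenFock g) ≠ 0 := by
    intro h0
    refine hne (ContinuousLinearMap.ext fun x => ?_)
    have := congrArg (fun R : FockSpace h →L[ℂ] FockSpace h => R (G.dressingToFock g x)) h0
    simpa using this
  refine G.mem_range_toAntidual_of_intertwines hne' fun f x y hxy => ?_
  have h1 : ((G.dressingToFock g).symm x, (G.dressingToFock g).symm y +
      ((Real.sqrt 2 * (bracket g f).re : ℝ) : ℂ) • (G.dressingToFock g).symm x)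
        ∈ ((G.fields g).φ f).graph := by
    rw [mem_fields_graph, map_add, map_smul, LinearIsometryEquiv.apply_symm_apply,
      LinearIsometryEquiv.apply_symm_apply, add_sub_cancel_right]
    exact hxy
  have h2 := (hS f).1.map_mem_graph h1
  rw [map_add, map_smul] at h2
  exact h2

end GelfandTriple

end VanHove

end

theorem mainTheorem6 {T h : Type*} [AddCommGroup T] [Module ℂ T] [TopologicalSpace T]
    [IsTopologicalAddGroup T] [ContinuousSMul ℂ T]
    [NormedAddCommGroup h] [InnerProductSpace ℂ h] [CompleteSpace h]
    (G : VanHove.GelfandTriple T h) :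
    (∀ (g g' : T →L⋆[ℂ] ℂ) (f : T),
      (G.fields g).φ f
        = VanHove.sandwich (G.dressing g' g)
            (VanHove.addScalar ((G.fields g').φ f)
              (Real.sqrt 2 * (VanHove.GelfandTriple.bracket (g - g') f).re : ℝ))
            (G.dressing g g') ∧
      (G.fields g).π f
        = VanHove.sandwich (G.dressing g' g)
            (VanHove.addScalar ((G.fields g').π f)
              (Real.sqrt 2 * (VanHove.GelfandTriple.bracket (g - g') f).im : ℝ))
            (G.dressing g g')) ∧
    (∀ g g' : T →L⋆[ℂ] ℂ,
      VanHove.UnitarilyEquivalent (G.fields g) (G.fields g') ↔ g - g' ∈ Set.range G.toAntidual) ∧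
    (∀ g : T →L⋆[ℂ] ℂ, g ∉ Set.range G.toAntidual →
      VanHove.DisjointRep (G.fields g) G.fockFields) :=
  ⟨fun g g' f => ⟨G.fields_φ_eq_sandwich g g' f, G.fields_π_eq_sandwich g g' f⟩,
    fun _ _ => ⟨G.mem_range_of_unitarilyEquivalent, G.unitarilyEquivalent_of_mem_range⟩,
    fun _ => G.disjointRep_of_notMem_range⟩
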